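/- \begin{theorem} Let $K$ be a field and let $A$ be a finite dimensional, basic and elementary Nakayama $K$-algebra whose quiver is the oriented cycle $0\to 1\to\cdots\to n-1\to 0$ ($n\ge 1$). Let $(e_i)_{i\in\mathbb{Z}/n}$ be the corresponding primitive orthogonal idempotents, so that $\dim_K e_i(J/J^2)e_j=1$ if $j=i+1$ and $=0$ otherwise, where $J$ is the Jacobson radical of $A$. Modules are finite dimensional right modules, $D=\mathrm{Hom}_K(-,K)$, and $S_i$ denotes the simple top of $e_iA$. Assume that $A$ is not selfinjective. Terminology. The \emph{dominant dimension} of a module $M$ with minimal injective resolution $0\to M\to I_0\to I_1\to\cdots$ is the supremum of all $m\ge 0$ such that $I_0,\dots,I_{m-1}$ are projective, and $\mathrm{Dom}_2$ is the class of modules of dominant dimension at least $2$. The \emph{resolution quiver} of $A$ has the vertices $i\in\mathbb{Z}/n$ and an arrow $i\to j$ iff $S_j\cong\tau(\mathrm{soc}\,P(S_i))$, where $P(S_i)$ is the projective cover of $S_i$ and $\tau=D\,\mathrm{Tr}$. A vertex $i$ is \emph{black} if $S_i$ has projective dimension at least $2$, and \emph{cyclically black} if it lies on a cycle of the resolution quiver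 all of whose vertices are black. A module $M$ is \emph{Gorenstein projective} if $\mathrm{Ext}^l(M,A)=0=\mathrm{Ext}^l(\mathrm{Tr}\,M,A)$ for all $l\ge 1$. The \emph{Gorenstein core} of $A$ consists of all finite direct sums of indecomposable nonprojective Gorenstein projective modules and of projective covers of such modules. $A$ is \emph{Gorenstein dominant} if $A$ has dominant dimension at least $1$ as a right module and every Gorenstein projective module without nonzero projective direct summands has dominant dimension at least $2$. Then: \begin{enumerate} \item If a vertex $i$ is cyclically black, then the right module $D(Ae_{i-1})$ is projective. \item The Gorenstein core of $A$ is contained in $\mathrm{Dom}_2$, and $A$ is Gorenstein dominant. \end{enumerate} \end{theorem} -/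

import Mathlib

universe u

/-! ### Modules over an arbitrary ring -/

namespace Nak

/-- A module is uniserial if its submodules form a chain. -/
def IsUniserial (R : Type u) [Ring R] (M : Type u) [AddCommGroup M] [Module R M] : Prop :=
  ∀ N N' : Submodule R M, N ≤ N' ∨ N' ≤ N

/-- An indecomposable module: nonzero, and with no nontrivial direct sum decomposition. -/
def IsIndecomposable (R : Type u) [Ring R] (M : Type u) [AddCommGroup M] [Module R M] : Prop :=
  Nontrivial M ∧ ∀ N N' : Submodule R M, IsCompl N N' → N = ⊥ ∨ N' = ⊥

/-- `f : P → M` is a projective cover: `P` is projective, `f` is onto and its kernel is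
superfluous. -/
structure IsProjectiveCover {R : Type u} [Ring R] {P M : Type u} [AddCommGroup P] [Module R P]
    [AddCommGroup M] [Module R M] (f : P →ₗ[R] M) : Prop where
  projective : Module.Projective R P
  surjective : Function.Surjective f
  superfluous : ∀ N : Submodule R P, N ⊔ LinearMap.ker f = ⊤ → N = ⊤

/-- The socle of a module: the sum of its simple submodules. -/
def socle (R : Type u) [Ring R] (M : Type u) [AddCommGroup M] [Module R M] : Submodule R M :=
  sSup {N : Submodule R M | IsSimpleModule R N}

/-- A minimal projective presentation `P₁ → P₀ → M → 0` by finitely generated modules. -/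
structure MinProjPres (R : Type u) [Ring R] (M : Type u) [AddCommGroup M] [Module R M] where
  P₀ : ModuleCat.{u} R
  P₁ : ModuleCat.{u} R
  finite₀ : Module.Finite R P₀
  finite₁ : Module.Finite R P₁
  ε : P₀ →ₗ[R] M
  d : P₁ →ₗ[R] P₀
  cover₀ : IsProjectiveCover ε
  exact : Function.Exact d ε
  cover₁ : IsProjectiveCover d.rangeRestrict

/-- A minimal injective resolution `0 → M → I₀ → I₁ → ⋯`. -/
structure MinInjRes (R : Type u) [Ring R] (M : Type u) [AddCommGroup M] [Module R M] where
  I : ℕ → ModuleCat.{u} R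
  ι : M →ₗ[R] I 0
  d : ∀ n, I n →ₗ[R] I (n + 1)
  injective : ∀ n, Module.Injective R (I n)
  ι_injective : Function.Injective ι
  exact_zero : Function.Exact ι (d 0)
  exact_succ : ∀ n, Function.Exact (d n) (d (n + 1))
  essential_ι : ∀ N : Submodule R (I 0), N ⊓ LinearMap.range ι = ⊥ → N = ⊥
  essential_d : ∀ n, ∀ N : Submodule R (I (n + 1)), N ⊓ LinearMap.range (d n) = ⊥ → N = ⊥

/-- The supremum of all `n` such that `I₀, …, Iₙ₋₁` are projective. -/
noncomputable def MinInjRes.domDim {R : Type u} [Ring R] {M : Type u} [AddCommGroup M] [Module R M]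
    (ρ : MinInjRes R M) : ℕ∞ :=
  ⨆ n : {n : ℕ // ∀ i < n, Module.Projective R (ρ.I i)}, ((n : ℕ) : ℕ∞)

/-- The dominant dimension of a module. Minimal injective resolutions exist and are unique up to
isomorphism, so the supremum is over copies of one and the same value. -/
noncomputable def domDim (R : Type u) [Ring R] (M : Type u) [AddCommGroup M] [Module R M] : ℕ∞ :=
  ⨆ ρ : MinInjRes R M, ρ.domDim

/-- `Extⁱ(X, Y) = 0` for all `i ≥ 1`. -/
def ExtVanish (R : Type u) [Ring R] (X Y : Type u) [AddCommGroup X] [Module R X]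
    [AddCommGroup Y] [Module R Y] : Prop :=
  ∀ i : ℕ, 1 ≤ i →
    Subsingleton (CategoryTheory.Abelian.Ext.{u} (ModuleCat.of R X) (ModuleCat.of R Y) i)

/-! ### The dualities `D = Hom_K(-, K)` and `Tr`

Right `A`-modules are modules over `Aᵐᵒᵖ`, left `A`-modules are modules over `A`. -/

/-- `D(M) = Hom_K(M, K)`, for a left `A`-module `M`. -/
def KDual (K M : Type u) [Field K] [AddCommGroup M] [Module K M] : Type u := M →ₗ[K] K

noncomputable instance (K M : Type u) [Field K] [AddCommGroup M] [Module K M] :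
    AddCommGroup (KDual K M) :=
  inferInstanceAs (AddCommGroup (M →ₗ[K] K))

/-- `D(M)` is a right `A`-module through `(f · a)(x) = f (a x)`. -/
noncomputable instance (K A M : Type u) [Field K] [Ring A] [Algebra K A] [AddCommGroup M]
    [Module K M] [Module A M] [IsScalarTower K A M] : Module Aᵐᵒᵖ (KDual K M) where
  smul a f := LinearMap.comp (show M →ₗ[K] K from f) (Algebra.lsmul K K M a.unop)
  one_smul f := LinearMap.ext fun x => congrArg (show M →ₗ[K] K from f) (one_smul A x)
  mul_smul a b f := LinearMap.ext fun x =>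
    congrArg (show M →ₗ[K] K from f) (mul_smul b.unop a.unop x)
  smul_zero _ := LinearMap.ext fun _ => rfl
  smul_add _ _ _ := LinearMap.ext fun _ => rfl
  add_smul a b f := LinearMap.ext fun x =>
    (congrArg (show M →ₗ[K] K from f) (add_smul a.unop b.unop x)).trans
      (map_add (show M →ₗ[K] K from f) _ _)
  zero_smul f := LinearMap.ext fun x =>
    (congrArg (show M →ₗ[K] K from f) (zero_smul A x)).trans
      (map_zero (show M →ₗ[K] K from f))

/-- For a map `d : P₁ → P₀` of right `A`-modules, the map of left `A`-modules
`Hom_A(P₀, A) → Hom_A(P₁, A)` given by composition with `d`. -/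
def homMap {A : Type u} [Ring A] {P₁ P₀ : Type u} [AddCommGroup P₁] [Module Aᵐᵒᵖ P₁]
    [AddCommGroup P₀] [Module Aᵐᵒᵖ P₀] (d : P₁ →ₗ[Aᵐᵒᵖ] P₀) :
    (P₀ →ₗ[Aᵐᵒᵖ] A) →ₗ[A] (P₁ →ₗ[Aᵐᵒᵖ] A) where
  toFun g := g.comp d
  map_add' _ _ := rfl
  map_smul' _ _ := rfl

/-- The transpose `Tr M = coker (Hom_A(P₀, A) → Hom_A(P₁, A))` of a right `A`-module `M`, computed
from a minimal projective presentation `P₁ → P₀ → M → 0`. It is a left `A`-module. -/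
abbrev MinProjPres.Tr {A : Type u} [Ring A] {M : Type u} [AddCommGroup M] [Module Aᵐᵒᵖ M]
    (π : MinProjPres Aᵐᵒᵖ M) : Type u :=
  (π.P₁ →ₗ[Aᵐᵒᵖ] A) ⧸ LinearMap.range (homMap π.d)

/-- `N ≅ τ(M) = D(Tr M)`, for right `A`-modules `M` and `N`. -/
def IsTau (K A : Type u) [Field K] [Ring A] [Algebra K A] (N M : Type u) [AddCommGroup N]
    [Module Aᵐᵒᵖ N] [AddCommGroup M] [Module Aᵐᵒᵖ M] : Prop :=
  ∃ π : MinProjPres Aᵐᵒᵖ M, Nonempty (N ≃ₗ[Aᵐᵒᵖ] KDual K π.Tr)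

/-! ### Gorenstein projective modules -/

/-- A (finite dimensional) right `A`-module `M` is Gorenstein projective if
`Extⁱ(M, A) = 0 = Extⁱ(Tr M, A)` for all `i ≥ 1`. -/
def IsGorensteinProjective (A : Type u) [Ring A] (M : Type u) [AddCommGroup M]
    [Module Aᵐᵒᵖ M] : Prop :=
  Module.Finite Aᵐᵒᵖ M ∧ ExtVanish Aᵐᵒᵖ M A ∧ ∃ π : MinProjPres Aᵐᵒᵖ M, ExtVanish A π.Tr A

/-- `M` lies in `RGp(A)`: it is Gorenstein projective and has no nonzero projective direct
summand. -/
def InRGp (A : Type u) [Ring A] (M : Type u) [AddCommGroup M] [Module Aᵐᵒᵖ M] : Prop :=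
  IsGorensteinProjective A M ∧
    ∀ N N' : Submodule Aᵐᵒᵖ M, IsCompl N N' → Module.Projective Aᵐᵒᵖ N → N = ⊥

/-- `A` is Gorenstein dominant: the right module `A` has dominant dimension at least one and all
modules in `RGp(A)` have dominant dimension at least two. -/
def IsGorensteinDominant (A : Type u) [Ring A] : Prop :=
  1 ≤ domDim Aᵐᵒᵖ A ∧
    ∀ (M : Type u) [AddCommGroup M] [Module Aᵐᵒᵖ M], InRGp A M → 2 ≤ domDim Aᵐᵒᵖ M

/-- `X` is an indecomposable nonprojective Gorenstein projective module. -/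
def IsIndecNonprojGp (A : Type u) [Ring A] (X : Type u) [AddCommGroup X] [Module Aᵐᵒᵖ X] : Prop :=
  IsIndecomposable Aᵐᵒᵖ X ∧ ¬ Module.Projective Aᵐᵒᵖ X ∧ IsGorensteinProjective A X

/-- `M` lies in the Gorenstein core: it is a finite direct sum of indecomposable nonprojective
Gorenstein projective modules and of projective covers of such modules. -/
def InGorensteinCore (A : Type u) [Ring A] (M : Type u) [AddCommGroup M] [Module Aᵐᵒᵖ M] : Prop :=
  ∃ (m : ℕ) (X : Fin m → ModuleCat.{u} Aᵐᵒᵖ),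
    (∀ k, IsIndecNonprojGp A (X k) ∨
      ∃ (G : ModuleCat.{u} Aᵐᵒᵖ) (f : X k →ₗ[Aᵐᵒᵖ] G),
        IsIndecNonprojGp A G ∧ IsProjectiveCover f) ∧
    Nonempty (M ≃ₗ[Aᵐᵒᵖ] (∀ k, X k))

/-! ### Cyclic Nakayama algebras -/

/-- The right ideal `xA`. -/
abbrev rightIdeal {A : Type u} [Ring A] (x : A) : Submodule Aᵐᵒᵖ A := Submodule.span Aᵐᵒᵖ {x}

/-- The left ideal `Ax`. -/
abbrev leftIdeal {A : Type u} [Ring A] (x : A) : Submodule A A := Submodule.span A {x}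

/-- `dim_K x (J / J²) y`, where `J` is the Jacobson radical of `A`. For primitive idempotents `x`
and `y` of a basic elementary algebra this is the number of arrows from `x` to `y` in the quiver
of `A`. -/
noncomputable def arrowCount (K : Type u) {A : Type u} [Field K] [Ring A] [Algebra K A]
    (x y : A) : ℕ :=
  Module.finrank K
    (((Ring.jacobson A).restrictScalars K).map
      ((((Ring.jacobson A) * (Ring.jacobson A) : Ideal A).restrictScalars K).mkQ ∘ₗ
        LinearMap.mulLeft K x ∘ₗ LinearMap.mulRight K y))

/-- `A` is a basic and elementary Nakayama algebra over `K` with `n` simple modules whose quiver is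
the oriented cycle `0 → 1 → ⋯ → n - 1 → 0`, the vertices being given by the complete set `e` of
primitive orthogonal idempotents. -/
structure IsCNakayama (K : Type u) {A : Type u} [Field K] [Ring A] [Algebra K A] {n : ℕ}
    [NeZero n] (e : ZMod n → A) : Prop where
  finite : Module.Finite K A
  idem : CompleteOrthogonalIdempotents e
  /-- `A / J ≅ Kⁿ`, with `e i` corresponding to the `i`-th unit vector. -/
  elementary : ∃ φ : A →ₐ[K] (ZMod n → K),
    (∀ i, φ (e i) = Pi.single i 1) ∧ RingHom.ker φ = Ring.jacobson A
  /-- The indecomposable projective right modules are uniserial. -/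
  right_uniserial : ∀ i, IsUniserial Aᵐᵒᵖ (rightIdeal (e i))
  /-- The indecomposable projective left modules are uniserial. -/
  left_uniserial : ∀ i, IsUniserial A (leftIdeal (e i))
  quiver : ∀ i j, arrowCount K (e i) (e j) = if j = i + 1 then 1 else 0

/-- The simple right module `Sᵢ = top (eᵢA)` of the vertex `i`. -/
abbrev simpleAt {A : Type u} [Ring A] {n : ℕ} (e : ZMod n → A) (i : ZMod n) : Type u :=
  rightIdeal (e i) ⧸ Module.jacobson Aᵐᵒᵖ (rightIdeal (e i))

/-- There is an arrow from `i` to `j` in the resolution quiver: `Sⱼ ≅ τ(soc P(Sᵢ))`. -/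
def ResArrow (K : Type u) {A : Type u} [Field K] [Ring A] [Algebra K A] {n : ℕ}
    (e : ZMod n → A) (i j : ZMod n) : Prop :=
  ∃ (P : ModuleCat.{u} Aᵐᵒᵖ) (f : P →ₗ[Aᵐᵒᵖ] simpleAt e i),
    IsProjectiveCover f ∧ IsTau K A (simpleAt e j) (socle Aᵐᵒᵖ P)

/-- The vertex `i` is black: `Sᵢ` has projective dimension at least two. -/
def IsBlack {A : Type u} [Ring A] {n : ℕ} (e : ZMod n → A) (i : ZMod n) : Prop :=
  2 ≤ CategoryTheory.projectiveDimension (ModuleCat.of Aᵐᵒᵖ (simpleAt e i))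

/-- The vertex `i` is cyclically black: it lies on a cycle `i = v 0 → v 1 → ⋯ → v m = i` of the
resolution quiver all of whose vertices are black. -/
def IsCyclicallyBlack (K : Type u) {A : Type u} [Field K] [Ring A] [Algebra K A] {n : ℕ}
    (e : ZMod n → A) (i : ZMod n) : Prop :=
  ∃ (m : ℕ) (v : ℕ → ZMod n), 1 ≤ m ∧ v 0 = i ∧ v m = i ∧
    ∀ k < m, ResArrow K e (v k) (v (k + 1)) ∧ IsBlack e (v k)

end Nak

/-! Write modules on the right and call j a socle vertex if S_j embeds in A (`SocleVertex`). If s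
e_j spans such a copy, multiply it on the left until the left radical kills it too. The result t
lies in the right socle of some e_wA and in the left socle of Ae_j. Both modules are uniserial, so
every nonzero x in e_wA has a multiple equal to t, and likewise every nonzero y in Ae_j. A
functional not vanishing at t therefore makes (x, y) ↦ xy a perfect pairing, and e_wA ≅ D(Ae_j) is
projective and injective (`nonempty_equiv_kdual`). Every e_iA embeds in such a module, so A embeds
in a finitely generated projective-injective F (`exists_projective_injective`).

For the first claim it remains to see that an arrow k → i of the resolution quiver makes i-1 a socle
vertex (`socleVertex_of_resArrow`). If S_i ≅ τ(soc P), then S_i occurs in the top of P₁ in a minimal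
presentation P₁ → P₀ → soc P. As d maps P₁ into the radical of P₀ and the only arrow ending at i
starts at i-1, S_{i-1} occurs in soc P, hence embeds in A.

For the second claim, a torsionless X has a projective injective hull E, and dominant dimension at
least 2 follows once E/X embeds in a power of F, that is, once every simple in soc(E/X) embeds in A.
This holds if X is balanced (`IsBalanced`): X e_{j+1} ⊆ X α_j whenever j is not a socle vertex
(`IsCNakayama.two_le_domDim`). Vanishing of Ext¹(Tr M, A) and Ext²(Tr M, A) makes a Gorenstein
projective M a second syzygy (`isSecondSyzygy`). A second syzygy without projective summands is
balanced (`IsCNakayama.isBalanced`). Balance passes to projective covers and finite sums, which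
handles the Gorenstein core. -/

namespace Nak

/-! ### Injective hulls and minimal injective resolutions -/

section InjectiveHulls

variable {R : Type u} [Ring R]

theorem injective_of_retract {E I : Type u} [AddCommGroup E] [Module R E] [AddCommGroup I]
    [Module R I] [Module.Injective R I] (i : E →ₗ[R] I) (p : I →ₗ[R] E)
    (h : p ∘ₗ i = LinearMap.id) : Module.Injective R E where
  out X Y _ _ _ _ f hf g := by
    obtain ⟨k, hk⟩ := Module.Injective.out f hf (i ∘ₗ g)
    exact ⟨p ∘ₗ k, fun x => by simpa [hk] using LinearMap.congr_fun h (g x)⟩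

/-- A submodule of an injective module lies in an injective essential extension. -/
theorem exists_injective_essential {I : Type u} [AddCommGroup I] [Module R I]
    [Module.Injective R I] (X : Submodule R I) :
    ∃ E : Submodule R I, X ≤ E ∧ Module.Injective R E ∧
      ∀ x ∈ E, x ≠ 0 → ∃ r : R, r • x ∈ X ∧ r • x ≠ 0 := by
  obtain ⟨E, hXE, ⟨⟨-, hE⟩, hmax⟩⟩ := zorn_le_nonempty₀
    {E : Submodule R I | X ≤ E ∧ ∀ x ∈ E, x ≠ 0 → ∃ r : R, r • x ∈ X ∧ r • x ≠ 0}
    (fun c hc hch y hy => ⟨sSup c, ⟨(hc hy).1.trans (le_sSup hy), fun x hx hx0 => by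
      obtain ⟨E, hEc, hxE⟩ := (Submodule.mem_sSup_of_directed ⟨y, hy⟩ hch.directedOn).1 hx
      exact (hc hEc).2 x hxE hx0⟩, fun z hz => le_sSup hz⟩)
    X ⟨le_rfl, fun x hx hx0 => ⟨1, by simpa using hx, by simpa using hx0⟩⟩
  -- With C maximal among submodules meeting E trivially, E embeds essentially in I/C. Extending E →
  -- I to g : I/C → I gives an image that is again essential over X, so it equals E by maximality,
  -- and g composed with I → I/C is a retraction onto E.
  obtain ⟨C, -, ⟨hC, hCmax⟩⟩ := zorn_le_nonempty₀
    {C : Submodule R I | ∀ x ∈ C, x ∈ E → x = 0}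
    (fun c hc hch y hy => ⟨sSup c, fun x hx hxE => by
      obtain ⟨C, hCc, hxC⟩ := (Submodule.mem_sSup_of_directed ⟨y, hy⟩ hch.directedOn).1 hx
      exact hc hCc x hxC hxE, fun z hz => le_sSup hz⟩)
    ⊥ (fun x hx _ => by simpa using hx)
  have key : ∀ y ∉ C, ∃ c ∈ C, ∃ r : R, c + r • y ∈ E ∧ c + r • y ≠ 0 := by
    intro y hy
    by_contra! hcon
    refine hy (hCmax (y := C ⊔ Submodule.span R {y}) ?_ le_sup_left
      (Submodule.mem_sup_right (Submodule.mem_span_singleton_self y)))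
    intro x hx hxE
    obtain ⟨c, hc, z, hz, rfl⟩ := Submodule.mem_sup.1 hx
    obtain ⟨r, rfl⟩ := Submodule.mem_span_singleton.1 hz
    exact hcon c hc r hxE
  have hf : Function.Injective (C.mkQ ∘ₗ E.subtype) := by
    rw [injective_iff_map_eq_zero]
    rintro ⟨x, hx⟩ h
    exact Subtype.ext (hC x ((Submodule.Quotient.mk_eq_zero C).1 h) hx)
  obtain ⟨g, hg⟩ := Module.Injective.out _ hf E.subtype
  have key' : ∀ y ∉ C, ∃ r : R, r • g (C.mkQ y) ∈ E ∧ r • g (C.mkQ y) ≠ 0 := by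
    intro y hy
    obtain ⟨c, hc, r, he, h0⟩ := key y hy
    have h2 : r • g (C.mkQ y) = c + r • y := by
      have := hg ⟨_, he⟩
      simp only [LinearMap.comp_apply, Submodule.subtype_apply, map_add] at this
      rwa [show C.mkQ c = 0 from (Submodule.Quotient.mk_eq_zero C).2 hc, map_zero, zero_add,
        map_smul, map_smul] at this
    exact ⟨r, h2 ▸ he, h2 ▸ h0⟩
  have hle : LinearMap.range g ≤ E := by
    refine hmax (y := LinearMap.range g) ⟨?_, ?_⟩ ?_
    · intro x hx
      exact ⟨_, hg ⟨x, hXE hx⟩⟩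
    · rintro _ ⟨q, rfl⟩ h0
      obtain ⟨y, rfl⟩ := C.mkQ_surjective q
      have hy : y ∉ C := fun h => h0 (by
        rw [show C.mkQ y = 0 from (Submodule.Quotient.mk_eq_zero C).2 h, map_zero])
      obtain ⟨r, hr, hr0⟩ := key' y hy
      obtain ⟨s, hs, hs0⟩ := hE _ hr hr0
      exact ⟨s * r, by rwa [mul_smul], by rwa [mul_smul]⟩
    · intro x hx
      exact ⟨_, hg ⟨x, hx⟩⟩
  refine ⟨E, hXE, injective_of_retract E.subtype
    ((g ∘ₗ C.mkQ).codRestrict E fun y => hle ⟨_, rfl⟩) ?_, hE⟩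
  ext x
  exact hg x

theorem exists_injective_hull (M : Type u) [AddCommGroup M] [Module R M] :
    ∃ (E : ModuleCat.{u} R) (ι : M →ₗ[R] E), Module.Injective R E ∧ Function.Injective ι ∧
      ∀ x : E, x ≠ 0 → ∃ (r : R) (m : M), r • x = ι m ∧ r • x ≠ 0 := by
  let I : ModuleCat.{u} R := CategoryTheory.Injective.under (ModuleCat.of R M)
  have : CategoryTheory.Injective (ModuleCat.of R I) :=
    inferInstanceAs (CategoryTheory.Injective (CategoryTheory.Injective.under (ModuleCat.of R M)))
  have hI : Module.Injective R I := Module.injective_module_of_injective_object R I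
  let j : M →ₗ[R] I := (CategoryTheory.Injective.ι (ModuleCat.of R M)).hom
  have hj : Function.Injective j :=
    (ModuleCat.mono_iff_injective (CategoryTheory.Injective.ι (ModuleCat.of R M))).1 inferInstance
  obtain ⟨E, hXE, hE, hess⟩ := exists_injective_essential (LinearMap.range j)
  refine ⟨ModuleCat.of R E, j.codRestrict E fun m => hXE ⟨m, rfl⟩, hE, fun a b h =>
    hj (congrArg Subtype.val h), ?_⟩
  rintro ⟨x, hx⟩ h0
  obtain ⟨r, ⟨m, hm⟩, hr⟩ := hess x hx fun h => h0 (Subtype.ext h)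
  exact ⟨r, m, Subtype.ext hm.symm, fun h => hr (congrArg Subtype.val h)⟩

variable (R) in
/-- An injective hull of a module. -/
noncomputable def hull (M : Type u) [AddCommGroup M] [Module R M] : ModuleCat.{u} R :=
  (exists_injective_hull (R := R) M).choose

section

variable (M : Type u) [AddCommGroup M] [Module R M]

variable (R) in
/-- The embedding of a module into its injective hull. -/
noncomputable def hullι : M →ₗ[R] hull R M :=
  (exists_injective_hull (R := R) M).choose_spec.choose

instance hull_injective : Module.Injective R (hull R M) :=
  (exists_injective_hull (R := R) M).choose_spec.choose_spec.1

theorem hullι_injective : Function.Injective (hullι R M) :=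
  (exists_injective_hull (R := R) M).choose_spec.choose_spec.2.1

variable {M} in
theorem hull_essential (x : hull R M) (hx : x ≠ 0) :
    ∃ (r : R) (m : M), r • x = hullι R M m ∧ r • x ≠ 0 :=
  (exists_injective_hull (R := R) M).choose_spec.choose_spec.2.2 x hx

theorem hull_inf_range (N : Submodule R (hull R M)) (h : N ⊓ LinearMap.range (hullι R M) = ⊥) :
    N = ⊥ := by
  rw [eq_bot_iff]
  intro x hx
  by_contra h0
  obtain ⟨r, m, hm, hr⟩ := hull_essential x h0
  exact hr ((Submodule.mem_bot R).1 (h ▸ ⟨N.smul_mem r hx, ⟨m, hm.symm⟩⟩))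

variable {M} in
/-- The injective hull of `M` is a retract of every injective module containing `M`. -/
theorem exists_retract_hull {F : Type u} [AddCommGroup F] [Module R F] [Module.Injective R F]
    (f : M →ₗ[R] F) (hf : Function.Injective f) :
    ∃ (i : hull R M →ₗ[R] F) (p : F →ₗ[R] hull R M), p ∘ₗ i = LinearMap.id := by
  obtain ⟨i, hi⟩ := Module.Injective.out (hullι R M) (hullι_injective M) f
  have hinj : Function.Injective i := by
    rw [injective_iff_map_eq_zero]
    intro x hx
    by_contra h0
    obtain ⟨r, m, hm, hr⟩ := hull_essential x h0
    have : f m = 0 := by rw [← hi, ← hm, map_smul, hx, smul_zero]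
    rw [hm, (map_eq_zero_iff f hf).1 this, map_zero] at hr
    exact hr rfl
  obtain ⟨p, hp⟩ := Module.Injective.out i hinj LinearMap.id
  exact ⟨i, p, LinearMap.ext hp⟩

end

/-- The iterated cosyzygies of a module. -/
noncomputable def cosyzygy (M : ModuleCat.{u} R) : ℕ → ModuleCat.{u} R
  | 0 => M
  | n + 1 => ModuleCat.of R
      (hull R (cosyzygy M n) ⧸ LinearMap.range (hullι R (cosyzygy M n)))

/-- The projection from the injective hull of a cosyzygy to the next cosyzygy. -/
noncomputable def cosyzygyMk (M : ModuleCat.{u} R) (n : ℕ) :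
    hull R (cosyzygy M n) →ₗ[R] cosyzygy M (n + 1) :=
  Submodule.mkQ (LinearMap.range (hullι R (cosyzygy M n)))

theorem cosyzygyMk_surjective (M : ModuleCat.{u} R) (n : ℕ) :
    Function.Surjective (cosyzygyMk M n) :=
  Submodule.mkQ_surjective (LinearMap.range (hullι R (cosyzygy M n)))

theorem cosyzygyMk_eq_zero (M : ModuleCat.{u} R) (n : ℕ) (x : hull R (cosyzygy M n)) :
    cosyzygyMk M n x = 0 ↔ x ∈ LinearMap.range (hullι R (cosyzygy M n)) :=
  Submodule.Quotient.mk_eq_zero _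

variable (R) in
/-- The minimal injective resolution built from injective hulls. -/
noncomputable def minInjRes (M : Type u) [AddCommGroup M] [Module R M] : MinInjRes R M where
  I n := hull R (cosyzygy (ModuleCat.of R M) n)
  ι := hullι R M
  d n := hullι R (cosyzygy (ModuleCat.of R M) (n + 1)) ∘ₗ cosyzygyMk _ n
  injective _ := hull_injective _
  ι_injective := hullι_injective M
  exact_zero x := by
    rw [LinearMap.comp_apply, map_eq_zero_iff _ (hullι_injective _)]
    exact cosyzygyMk_eq_zero (ModuleCat.of R M) 0 x
  exact_succ n x := by
    rw [LinearMap.comp_apply, map_eq_zero_iff _ (hullι_injective _), cosyzygyMk_eq_zero]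
    refine ⟨?_, ?_⟩
    · rintro ⟨y, rfl⟩
      obtain ⟨z, rfl⟩ := cosyzygyMk_surjective _ _ y
      exact ⟨z, rfl⟩
    · rintro ⟨z, rfl⟩
      exact ⟨_, rfl⟩
  essential_ι := hull_inf_range M
  essential_d n N hN := by
    refine hull_inf_range _ N ?_
    rwa [LinearMap.range_comp_of_range_eq_top _
      (LinearMap.range_eq_top.2 (cosyzygyMk_surjective _ n))] at hN

/-- `domDim` is a supremum over resolutions, so for a lower bound the single resolution `minInjRes`
suffices. -/
theorem one_le_domDim (M : Type u) [AddCommGroup M] [Module R M]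
    (h : Module.Projective R (hull R M)) : 1 ≤ domDim R M :=
  le_trans (le_iSup (fun n : {n : ℕ // ∀ i < n, Module.Projective R ((minInjRes R M).I i)} =>
    ((n : ℕ) : ℕ∞)) ⟨1, fun i hi => by obtain rfl : i = 0 := by lia
                                       exact h⟩)
    (le_iSup (fun ρ : MinInjRes R M => ρ.domDim) (minInjRes R M))

theorem two_le_domDim (M : Type u) [AddCommGroup M] [Module R M]
    (h : Module.Projective R (hull R M))
    (h' : Module.Projective R (hull R (hull R M ⧸ LinearMap.range (hullι R M)))) :
    2 ≤ domDim R M :=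
  le_trans (le_iSup (fun n : {n : ℕ // ∀ i < n, Module.Projective R ((minInjRes R M).I i)} =>
    ((n : ℕ) : ℕ∞)) ⟨2, fun i hi => by
      obtain rfl | rfl : i = 0 ∨ i = 1 := by lia
      · exact h
      · exact h'⟩)
    (le_iSup (fun ρ : MinInjRes R M => ρ.domDim) (minInjRes R M))

/-- The map g descends to the image of f, and injectivity of F extends it from there to all of C. -/
theorem exists_factor {B C F : Type u} [AddCommGroup B] [Module R B] [AddCommGroup C] [Module R C]
    [AddCommGroup F] [Module R F] [Module.Injective R F] (f : B →ₗ[R] C) (g : B →ₗ[R] F)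
    (h : LinearMap.ker f ≤ LinearMap.ker g) : ∃ k : C →ₗ[R] F, ∀ b, k (f b) = g b := by
  obtain ⟨k, hk⟩ := Module.Injective.out ((LinearMap.ker f).liftQ f le_rfl)
    (LinearMap.ker_eq_bot.1 (Submodule.ker_liftQ_eq_bot _ _ _ le_rfl))
    ((LinearMap.ker f).liftQ g h)
  exact ⟨k, fun b => by simpa using hk (Submodule.Quotient.mk b)⟩

/-- An artinian module whose points are separated by maps to `F` embeds into a power of `F`. -/
theorem exists_injective_pi {C F : Type u} [AddCommGroup C] [Module R C] [AddCommGroup F]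
    [Module R F] [IsArtinian R C] (h : ∀ c : C, c ≠ 0 → ∃ k : C →ₗ[R] F, k c ≠ 0) :
    ∃ (r : ℕ) (f : C →ₗ[R] (Fin r → F)), Function.Injective f := by
  -- Take a kernel minimal among maps to finite powers of F; adjoining a coordinate that separates
  -- one of its nonzero points would shrink it.
  obtain ⟨N, ⟨r, f, rfl⟩, hmin⟩ := (wellFounded_lt (α := Submodule R C)).has_min
    {N | ∃ (r : ℕ) (f : C →ₗ[R] (Fin r → F)), N = LinearMap.ker f} ⟨_, 0, 0, rfl⟩
  refine ⟨r, f, ?_⟩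
  rw [injective_iff_map_eq_zero]
  intro c hc
  by_contra h0
  obtain ⟨k, hk⟩ := h c h0
  let f' : C →ₗ[R] (Fin (r + 1) → F) :=
    LinearMap.pi (Fin.cons (α := fun _ => C →ₗ[R] F) k fun i => LinearMap.proj i ∘ₗ f)
  refine hmin (LinearMap.ker f') ⟨r + 1, f', rfl⟩ ?_
  rw [SetLike.lt_iff_le_and_exists]
  refine ⟨fun x hx => ?_, c, hc, fun hcon => hk (congrFun (LinearMap.mem_ker.1 hcon) 0)⟩
  rw [LinearMap.mem_ker] at hx ⊢
  ext i
  exact congrFun hx i.succ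

theorem projective_pi {ι : Type*} [Finite ι] (F : ι → Type*) [∀ i, AddCommGroup (F i)]
    [∀ i, Module R (F i)] [∀ i, Module.Projective R (F i)] : Module.Projective R (∀ i, F i) := by
  classical
  cases nonempty_fintype ι
  exact Module.Projective.of_equiv DFinsupp.linearEquivFunOnFintype

end InjectiveHulls

/-! ### Dual bases of finitely generated projective modules -/

section DualBasis

variable {A : Type u} [Ring A]

variable (A) in
/-- The regular right module is free of rank one. -/
def unopEquiv : Aᵐᵒᵖ ≃ₗ[Aᵐᵒᵖ] A where
  toFun := MulOpposite.unop
  invFun := MulOpposite.op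
  map_add' _ _ := rfl
  map_smul' _ _ := rfl

instance : Module.Projective Aᵐᵒᵖ A := Module.Projective.of_equiv (unopEquiv A)

instance : Module.Finite Aᵐᵒᵖ A := Module.Finite.equiv (unopEquiv A)

theorem exists_dual_basis (P : Type u) [AddCommGroup P] [Module Aᵐᵒᵖ P] [Module.Finite Aᵐᵒᵖ P]
    [Module.Projective Aᵐᵒᵖ P] : ∃ (k : ℕ) (x : Fin k → P) (f : Fin k → P →ₗ[Aᵐᵒᵖ] A),
      ∀ p, p = ∑ i, MulOpposite.op (f i p) • x i := by
  obtain ⟨k, g, hg⟩ := Module.Finite.exists_fin' Aᵐᵒᵖ P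
  obtain ⟨s, hs⟩ := Module.projective_lifting_property g LinearMap.id hg
  refine ⟨k, fun i => g (Pi.single i 1),
    fun i => (unopEquiv A).toLinearMap ∘ₗ LinearMap.proj i ∘ₗ s, fun p => ?_⟩
  conv_lhs => rw [← LinearMap.id_apply (R := Aᵐᵒᵖ) p, ← hs, LinearMap.comp_apply,
    LinearMap.pi_apply_eq_sum_univ g]
  refine Finset.sum_congr rfl fun i _ => ?_
  congr 2
  ext j
  simp [Pi.single_apply, eq_comm]

theorem exists_dual_ne_zero {P : Type u} [AddCommGroup P] [Module Aᵐᵒᵖ P] [Module.Finite Aᵐᵒᵖ P]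
    [Module.Projective Aᵐᵒᵖ P] {p : P} (hp : p ≠ 0) : ∃ f : P →ₗ[Aᵐᵒᵖ] A, f p ≠ 0 := by
  obtain ⟨k, x, f, h⟩ := exists_dual_basis (A := A) P
  by_contra! hcon
  exact hp (by rw [h p]; simp [hcon])

/-- Finitely generated projective modules are reflexive: every functional on the dual is an
evaluation. -/
theorem exists_eval {P : Type u} [AddCommGroup P] [Module Aᵐᵒᵖ P] [Module.Finite Aᵐᵒᵖ P]
    [Module.Projective Aᵐᵒᵖ P] (Λ : (P →ₗ[Aᵐᵒᵖ] A) →ₗ[A] A) : ∃ p : P, ∀ f, Λ f = f p := by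
  obtain ⟨k, x, g, h⟩ := exists_dual_basis (A := A) P
  refine ⟨∑ i, MulOpposite.op (Λ (g i)) • x i, fun f => ?_⟩
  have hf : f = ∑ i, f (x i) • g i := by
    ext p
    conv_lhs => rw [h p]
    simp
  conv_lhs => rw [hf]
  simp

theorem projective_dual (P : Type u) [AddCommGroup P] [Module Aᵐᵒᵖ P] [Module.Finite Aᵐᵒᵖ P]
    [Module.Projective Aᵐᵒᵖ P] : Module.Projective A (P →ₗ[Aᵐᵒᵖ] A) := by
  obtain ⟨k, x, g, h⟩ := exists_dual_basis (A := A) P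
  refine Module.Projective.of_split (M := Fin k → A)
    { toFun := fun f i => f (x i), map_add' := fun _ _ => rfl, map_smul' := fun _ _ => rfl }
    (Fintype.linearCombination A g) ?_
  ext f p
  conv_rhs => rw [h p]
  simp [Fintype.linearCombination_apply]

theorem finite_dual (P : Type u) [AddCommGroup P] [Module Aᵐᵒᵖ P] [Module.Finite Aᵐᵒᵖ P]
    [Module.Projective Aᵐᵒᵖ P] : Module.Finite A (P →ₗ[Aᵐᵒᵖ] A) := by
  obtain ⟨k, x, g, h⟩ := exists_dual_basis (A := A) P
  refine Module.Finite.of_surjective (Fintype.linearCombination A g) fun f => ⟨fun i => f (x i), ?_⟩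
  ext p
  conv_rhs => rw [h p]
  simp [Fintype.linearCombination_apply]

/-- Lift a finite free cover of M through f: the image of the lift together with ker f is all of P,
and ker f is superfluous. -/
theorem IsProjectiveCover.finite {R : Type u} [Ring R] {P M : Type u} [AddCommGroup P] [Module R P]
    [AddCommGroup M] [Module R M] {f : P →ₗ[R] M} (hf : IsProjectiveCover f) [Module.Finite R M] :
    Module.Finite R P := by
  obtain ⟨k, g, hg⟩ := Module.Finite.exists_fin' R M
  obtain ⟨s, hs⟩ := Module.projective_lifting_property f g hf.surjective
  refine Module.Finite.of_surjective s (LinearMap.range_eq_top.1 (hf.superfluous _ ?_))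
  rw [eq_top_iff]
  intro p _
  obtain ⟨y, hy⟩ := hg (f p)
  refine Submodule.mem_sup.2 ⟨s y, ⟨y, rfl⟩, p - s y, ?_, by abel⟩
  rw [LinearMap.mem_ker, map_sub, ← hy, ← hs, LinearMap.comp_apply, sub_self]

end DualBasis

end Nak

namespace Nak

/-! ### Extension of maps and dimension shifting from vanishing Ext -/

section ExtVanishing

open CategoryTheory

variable {A : Type u} [Ring A] {B P T Y : Type u} [AddCommGroup B] [Module A B]
  [AddCommGroup P] [Module A P] [AddCommGroup T] [Module A T] [AddCommGroup Y] [Module A Y]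

theorem shortExact_of_exact (f : B →ₗ[A] P) (g : P →ₗ[A] T) (hf : Function.Injective f)
    (hfg : Function.Exact f g) (hg : Function.Surjective g) :
    (ShortComplex.mk (ModuleCat.ofHom f) (ModuleCat.ofHom g)
      (by ext x; exact hfg.apply_apply_eq_zero x)).ShortExact where
  exact := (ShortComplex.ShortExact.moduleCat_exact_iff_function_exact _).2 hfg
  mono_f := (ModuleCat.mono_iff_injective _).2 hf
  epi_g := (ModuleCat.epi_iff_surjective _).2 hg

theorem exists_extension (f : B →ₗ[A] P) (g : P →ₗ[A] T) (hf : Function.Injective f)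
    (hfg : Function.Exact f g) (hg : Function.Surjective g)
    (h : Subsingleton (Abelian.Ext.{u} (ModuleCat.of A T) (ModuleCat.of A Y) 1))
    (k : B →ₗ[A] Y) : ∃ l : P →ₗ[A] Y, l ∘ₗ f = k := by
  obtain ⟨x, hx⟩ := Abelian.Ext.contravariant_sequence_exact₁ (shortExact_of_exact f g hf hfg hg)
    (ModuleCat.of A Y) (Abelian.Ext.mk₀ (ModuleCat.ofHom k)) (n₁ := 1) rfl (Subsingleton.elim _ _)
  obtain ⟨l, rfl⟩ := Abelian.Ext.mk₀_bijective _ _ |>.2 x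
  rw [Abelian.Ext.mk₀_comp_mk₀] at hx
  exact ⟨l.hom, congrArg ModuleCat.Hom.hom ((Abelian.Ext.mk₀_bijective _ _).1 hx)⟩

theorem ext_succ_subsingleton (f : B →ₗ[A] P) (g : P →ₗ[A] T) (hf : Function.Injective f)
    (hfg : Function.Exact f g) (hg : Function.Surjective g) [Module.Projective A P] (n : ℕ)
    (h : Subsingleton (Abelian.Ext.{u} (ModuleCat.of A T) (ModuleCat.of A Y) (n + 2))) :
    Subsingleton (Abelian.Ext.{u} (ModuleCat.of A B) (ModuleCat.of A Y) (n + 1)) := by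
  refine subsingleton_of_forall_eq 0 fun x => ?_
  have : Projective (ModuleCat.of A P) := inferInstance
  obtain ⟨y, rfl⟩ := Abelian.Ext.contravariant_sequence_exact₁
    (shortExact_of_exact f g hf hfg hg) (ModuleCat.of A Y) x (n₁ := n + 2) (by lia)
    (Subsingleton.elim _ _)
  have hy : y = 0 := Abelian.Ext.eq_zero_of_projective y
  rw [hy, Abelian.Ext.comp_zero]

end ExtVanishing

/-! ### Gorenstein projective modules are second syzygies -/

section Syzygies

variable {A : Type u} [Ring A] {M : Type u} [AddCommGroup M] [Module Aᵐᵒᵖ M]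

/-- `M` is the kernel of a map between free right modules: it embeds in a free module of finite
rank in such a way that the cokernel is torsionless. -/
def IsSecondSyzygy (A : Type u) [Ring A] (M : Type u) [AddCommGroup M] [Module Aᵐᵒᵖ M] : Prop :=
  ∃ (k : ℕ) (φ : M →ₗ[Aᵐᵒᵖ] (Fin k → A)), Function.Injective φ ∧
    ∀ q, (∀ θ : (Fin k → A) →ₗ[Aᵐᵒᵖ] A, θ ∘ₗ φ = 0 → θ q = 0) → q ∈ LinearMap.range φ

theorem exists_desc {R P M N : Type*} [Ring R] [AddCommGroup P] [Module R P]
    [AddCommGroup M] [Module R M] [AddCommGroup N] [Module R N] (f : P →ₗ[R] M)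
    (hf : Function.Surjective f) (g : P →ₗ[R] N) (h : ∀ p, f p = 0 → g p = 0) :
    ∃ k : M →ₗ[R] N, ∀ p, k (f p) = g p := by
  refine ⟨(LinearMap.ker f).liftQ g h ∘ₗ (f.quotKerEquivOfSurjective hf).symm.toLinearMap,
    fun p => ?_⟩
  have : (f.quotKerEquivOfSurjective hf).symm (f p) = Submodule.Quotient.mk p := by
    rw [LinearEquiv.symm_apply_eq]
    rfl
  exact (congrArg ((LinearMap.ker f).liftQ g h) this).trans (Submodule.liftQ_apply _ _ _)

/-- Dualizing P₁ → P₀ → M → 0 gives 0 → M* → P₀* → P₁* → Tr M → 0, with M* = ker d*. Ext¹(Tr M, A) =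
0 and Ext²(Tr M, A) = 0 let functionals extend from im d* to P₁* and from M* to P₀*, and functionals
on P₀* and P₁* are evaluations. Generators of M* are the coordinates of the embedding of M. -/
theorem IsGorensteinProjective.isSecondSyzygy [IsNoetherianRing A]
    (hM : IsGorensteinProjective A M) : IsSecondSyzygy A M := by
  obtain ⟨-, -, π, hπ⟩ := hM
  have := π.finite₀
  have := π.finite₁
  have h₀ : Module.Projective Aᵐᵒᵖ π.P₀ := π.cover₀.projective
  have h₁ : Module.Projective Aᵐᵒᵖ π.P₁ := π.cover₁.projective
  have := finite_dual (A := A) π.P₀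
  have hp₁ := projective_dual (A := A) π.P₁
  have ext₁ : ∀ k : LinearMap.range (homMap π.d) →ₗ[A] A,
      ∃ l : (π.P₁ →ₗ[Aᵐᵒᵖ] A) →ₗ[A] A, l ∘ₗ (LinearMap.range (homMap π.d)).subtype = k :=
    exists_extension _ (Submodule.mkQ _) (Submodule.subtype_injective _)
      (LinearMap.exact_subtype_mkQ _) (Submodule.mkQ_surjective _) (hπ 1 le_rfl)
  have ext₂ : ∀ k : LinearMap.ker (homMap π.d) →ₗ[A] A,
      ∃ l : (π.P₀ →ₗ[Aᵐᵒᵖ] A) →ₗ[A] A, l ∘ₗ (LinearMap.ker (homMap π.d)).subtype = k :=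
    exists_extension _ (homMap π.d).rangeRestrict (Submodule.subtype_injective _)
      (by
        intro x
        simp [LinearMap.rangeRestrict, Subtype.ext_iff])
      (LinearMap.surjective_rangeRestrict _)
      (ext_succ_subsingleton _ (Submodule.mkQ _) (Submodule.subtype_injective _)
        (LinearMap.exact_subtype_mkQ _) (Submodule.mkQ_surjective _) 0 (hπ 2 one_le_two))
  obtain ⟨k, G, hG⟩ := Module.Finite.exists_fin' A (LinearMap.ker (homMap π.d))
  have hGsum : ∀ (a : Fin k → A) (p : π.P₀),
      (G a).1 p = ∑ i, a i * (G (Pi.single i 1)).1 p := by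
    intro a p
    have ha : G a = ∑ i, a i • G (Pi.single i 1) := by
      conv_lhs => rw [LinearMap.pi_apply_eq_sum_univ G]
      refine Finset.sum_congr rfl fun i _ => ?_
      congr 2
      ext j
      simp [Pi.single_apply, eq_comm]
    rw [ha]
    simp
  have hker : ∀ (g : LinearMap.ker (homMap π.d)) (p : π.P₀), π.ε p = 0 → g.1 p = 0 := by
    intro g p hp
    obtain ⟨p', rfl⟩ := (π.exact p).1 hp
    exact LinearMap.congr_fun g.2 p'
  choose gbar hgbar using fun g : LinearMap.ker (homMap π.d) =>
    exists_desc π.ε π.cover₀.surjective g.1 (hker g)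
  have hφ : ∀ p i, LinearMap.pi (fun i => gbar (G (Pi.single i 1))) (π.ε p) i =
      (G (Pi.single i 1)).1 p := fun p i => hgbar _ p
  refine ⟨k, LinearMap.pi fun i => gbar (G (Pi.single i 1)), ?_, ?_⟩
  · rw [injective_iff_map_eq_zero]
    intro m hm
    obtain ⟨p, rfl⟩ := π.cover₀.surjective m
    have hgp : ∀ g ∈ LinearMap.ker (homMap π.d), g p = 0 := by
      intro g hg
      obtain ⟨a, ha⟩ := hG ⟨g, hg⟩
      have := hGsum a p
      rw [ha] at this
      rw [this]
      refine Finset.sum_eq_zero fun i _ => ?_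
      rw [← hφ, hm, Pi.zero_apply, mul_zero]
    -- Evaluation at p vanishes on M*, so it descends to im d* and extends to P₁*, where it is
    -- evaluation at some p₁; hence p = d p₁.
    let ev : (π.P₀ →ₗ[Aᵐᵒᵖ] A) →ₗ[A] A :=
      { toFun := fun f => f p, map_add' := fun _ _ => rfl, map_smul' := fun _ _ => rfl }
    let ρ : (π.P₀ →ₗ[Aᵐᵒᵖ] A) →ₗ[A] LinearMap.range (homMap π.d) := (homMap π.d).rangeRestrict
    have hρ : ∀ f, ρ f = 0 → ev f = 0 := fun f hf => hgp f (congrArg Subtype.val hf)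
    obtain ⟨κ, hκ⟩ := exists_desc (M := LinearMap.range (homMap π.d)) ρ (LinearMap.surjective_rangeRestrict _) ev hρ
    obtain ⟨l, hl⟩ := ext₁ κ
    obtain ⟨p₁, hp₁⟩ := exists_eval l
    have : p = π.d p₁ := by
      by_contra hne
      obtain ⟨f, hf⟩ := exists_dual_ne_zero (A := A) (sub_ne_zero.2 hne)
      refine hf ?_
      rw [map_sub, sub_eq_zero]
      refine (hκ f).symm.trans ?_
      rw [← hl]
      exact hp₁ _
    rw [this]
    exact π.exact.apply_apply_eq_zero p₁
  · intro q hq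
    -- A relation a among the generators of M* is a functional θ on A^k vanishing on M, so the
    -- hypothesis on q says exactly that Λ factors through G. Extended to P₀*, it becomes evaluation
    -- at a preimage of q.
    let Λ : (Fin k → A) →ₗ[A] A := Fintype.linearCombination A q
    obtain ⟨κ, hκ⟩ := exists_desc (M := LinearMap.ker (homMap π.d)) G hG Λ fun a ha => by
      let θ : (Fin k → A) →ₗ[Aᵐᵒᵖ] A :=
        { toFun := fun y => ∑ i, a i * y i
          map_add' := fun y z => by simp [mul_add, Finset.sum_add_distrib]
          map_smul' := fun c y => by simp [Finset.sum_mul, mul_assoc] }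
      have : θ q = 0 := hq θ (by
        ext m
        obtain ⟨p, rfl⟩ := π.cover₀.surjective m
        refine (Finset.sum_congr rfl fun i _ => by rw [hφ]).trans
          ((hGsum a p).symm.trans ?_)
        rw [ha]
        rfl)
      exact this
    obtain ⟨l, hl⟩ := ext₂ κ
    obtain ⟨p, hp⟩ := exists_eval l
    refine ⟨π.ε p, ?_⟩
    ext i
    rw [hφ, ← hp]
    have := LinearMap.congr_fun hl (G (Pi.single i 1))
    refine this.trans ((hκ _).trans ?_)
    simp [Λ, Fintype.linearCombination_apply, Pi.single_apply]

end Syzygies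

end Nak

namespace Nak

/-! ### Idempotents, arrows and powers of the radical -/

section Structure

variable {K A : Type u} [Field K] [Ring A] [Algebra K A] {n : ℕ} [NeZero n] {e : ZMod n → A}

theorem IsCNakayama.isArtinianRing (hA : IsCNakayama K e) : IsArtinianRing A :=
  have := hA.finite
  isArtinian_of_tower K inferInstance

theorem IsCNakayama.isNoetherianRing (hA : IsCNakayama K e) : IsNoetherianRing A :=
  have := hA.finite
  isNoetherian_of_tower K inferInstance

theorem IsCNakayama.exists_pow_eq_bot (hA : IsCNakayama K e) : ∃ m, Ring.jacobson A ^ m = ⊥ := by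
  have := hA.isArtinianRing
  exact IsSemiprimaryRing.isNilpotent (R := A)

theorem IsCNakayama.idem_mul (hA : IsCNakayama K e) (i : ZMod n) : e i * e i = e i :=
  hA.idem.idem i

theorem IsCNakayama.idem_ne_zero (hA : IsCNakayama K e) (i : ZMod n) : e i ≠ 0 := by
  obtain ⟨φ, hφ, -⟩ := hA.elementary
  intro h
  have := congrFun (hφ i) i
  rw [h, map_zero] at this
  simp at this

/-- Modulo the radical, an element acts on a primitive idempotent by a scalar. -/
theorem IsCNakayama.exists_scalar (hA : IsCNakayama K e) (a : A) (i : ZMod n) :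
    ∃ c : K, a * e i - c • e i ∈ Ring.jacobson A ∧ e i * a - c • e i ∈ Ring.jacobson A := by
  obtain ⟨φ, hφ, hker⟩ := hA.elementary
  refine ⟨φ a i, ?_, ?_⟩ <;> rw [← hker, RingHom.mem_ker] <;> ext j <;>
    by_cases h : j = i <;> simp [hφ, h]

theorem IsCNakayama.mul_mul_mem (hA : IsCNakayama K e) (a : A) {i j : ZMod n} (h : i ≠ j) :
    e i * a * e j ∈ Ring.jacobson A := by
  obtain ⟨φ, hφ, hker⟩ := hA.elementary
  rw [← hker, RingHom.mem_ker]
  ext k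
  by_cases h1 : k = i
  · subst h1
    simp [hφ, h]
  · simp [hφ, h1]

theorem IsCNakayama.exists_mul_idem_ne_zero (hA : IsCNakayama K e) {a : A} (ha : a ≠ 0) :
    ∃ j, a * e j ≠ 0 := by
  by_contra! h
  exact ha (by rw [← mul_one a, ← hA.idem.complete, Finset.mul_sum]; simp [h])

theorem IsCNakayama.exists_idem_mul_ne_zero (hA : IsCNakayama K e) {a : A} (ha : a ≠ 0) :
    ∃ j, e j * a ≠ 0 := by
  by_contra! h
  exact ha (by rw [← one_mul a, ← hA.idem.complete, Finset.sum_mul]; simp [h])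

/-- Elements `α j` representing the arrows `j → j + 1` of the quiver. -/
structure IsArrows (e α : ZMod n → A) : Prop where
  mem : ∀ j, α j ∈ Ring.jacobson A
  idem_mul : ∀ j, e j * α j = α j
  mul_idem : ∀ j, α j * e (j + 1) = α j
  left : ∀ j, ∀ y ∈ Ring.jacobson A, ∃ a, y * e (j + 1) = a * α j
  right : ∀ j, ∀ y ∈ Ring.jacobson A, ∃ a, e j * y = α j * a

theorem IsCNakayama.mul_mul_mem_sq (hA : IsCNakayama K e) {i j : ZMod n} (h : j ≠ i + 1) {y : A}
    (hy : y ∈ Ring.jacobson A) : e i * (y * e j) ∈ Ring.jacobson A * Ring.jacobson A := by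
  have := hA.finite
  have h0 := hA.quiver i j
  rw [if_neg h, arrowCount, Submodule.finrank_eq_zero] at h0
  exact (Submodule.Quotient.mk_eq_zero _).1 (LinearMap.le_ker_iff_map.2 h0 hy)

theorem IsCNakayama.exists_arrow (hA : IsCNakayama K e) (i : ZMod n) :
    ∃ x ∈ Ring.jacobson A, ∀ y ∈ Ring.jacobson A, ∃ c : K,
      e i * (y * e (i + 1)) - c • (e i * (x * e (i + 1))) ∈ Ring.jacobson A * Ring.jacobson A := by
  have h0 := hA.quiver i (i + 1)
  rw [if_pos rfl, arrowCount, finrank_eq_one_iff'] at h0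
  obtain ⟨⟨_, x, hx, rfl⟩, -, h⟩ := h0
  refine ⟨x, hx, fun y hy => ?_⟩
  obtain ⟨c, hc⟩ := h ⟨_, y, hy, rfl⟩
  refine ⟨c, (Submodule.Quotient.eq ((Ring.jacobson A * Ring.jacobson A).restrictScalars K)).1 ?_⟩
  exact (congrArg Subtype.val hc).symm

/-- Arrows may be lifted along the powers of the radical. -/
theorem exists_left_factor {J : Ideal A} [J.IsTwoSided] {m : ℕ} (hm : J ^ m = ⊥) {f α : A}
    (hf : f * f = f) (hα : α * f = α) (h : ∀ y ∈ J, ∃ a, y * f - a * α ∈ J * J) :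
    ∀ y ∈ J, ∃ a, y * f = a * α := by
  have step : ∀ k, ∀ y ∈ J ^ k * J, ∃ a, y * f - a * α ∈ J ^ (k + 1) * J := by
    intro k y hy
    refine Submodule.mul_induction_on hy (fun x hx y hy => ?_) fun x y hx hy => ?_
    · obtain ⟨a, ha⟩ := h y hy
      refine ⟨x * a, ?_⟩
      have := Ideal.mul_mem_mul hx ha
      rw [← mul_assoc (J ^ k), ← Submodule.pow_succ] at this
      convert! this using 1
      noncomm_ring
    · obtain ⟨a, ha⟩ := hx
      obtain ⟨b, hb⟩ := hy
      refine ⟨a + b, ?_⟩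
      convert! add_mem ha hb using 1
      noncomm_ring
  -- The errors are pushed into ever higher powers of J; l counts the corrections left before J ^ m
  -- = 0 ends the process.
  have main : ∀ l k, l + k = m → ∀ y ∈ J ^ k * J, ∃ a, y * f = a * α := by
    intro l
    induction l with
    | zero =>
      intro k hk y hy
      rw [zero_add] at hk
      rw [hk, hm, Submodule.bot_mul, Submodule.mem_bot] at hy
      exact ⟨0, by simp [hy]⟩
    | succ l ih =>
      intro k hk y hy
      obtain ⟨a, ha⟩ := step k y hy
      obtain ⟨b, hb⟩ := ih (k + 1) (by lia) _ ha
      refine ⟨a + b, ?_⟩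
      rw [sub_mul, mul_assoc, mul_assoc, hf, hα, sub_eq_iff_eq_add] at hb
      rw [hb, add_mul, add_comm]
  intro y hy
  exact main m 0 rfl y (by simpa [Submodule.pow_zero, Ideal.IsTwoSided.mul_one, Submodule.one_mul] using hy)

theorem exists_right_factor {J : Ideal A} [J.IsTwoSided] {m : ℕ} (hm : J ^ m = ⊥) {f α : A}
    (hf : f * f = f) (hα : f * α = α) (h : ∀ y ∈ J, ∃ a, f * y - α * a ∈ J * J) :
    ∀ y ∈ J, ∃ a, f * y = α * a := by
  have step : ∀ k, ∀ y ∈ J * J ^ k, ∃ a, f * y - α * a ∈ J * J ^ (k + 1) := by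
    intro k y hy
    refine Submodule.mul_induction_on hy (fun x hx y hy => ?_) fun x y hx hy => ?_
    · obtain ⟨a, ha⟩ := h x hx
      refine ⟨a * y, ?_⟩
      have := Ideal.mul_mem_mul ha hy
      rw [mul_assoc J, ← Ideal.IsTwoSided.pow_succ] at this
      convert! this using 1
      noncomm_ring
    · obtain ⟨a, ha⟩ := hx
      obtain ⟨b, hb⟩ := hy
      refine ⟨a + b, ?_⟩
      convert! add_mem ha hb using 1
      noncomm_ring
  have main : ∀ l k, l + k = m → ∀ y ∈ J * J ^ k, ∃ a, f * y = α * a := by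
    intro l
    induction l with
    | zero =>
      intro k hk y hy
      rw [zero_add] at hk
      rw [hk, hm, Submodule.mul_bot, Submodule.mem_bot] at hy
      exact ⟨0, by simp [hy]⟩
    | succ l ih =>
      intro k hk y hy
      obtain ⟨a, ha⟩ := step k y hy
      obtain ⟨b, hb⟩ := ih (k + 1) (by lia) _ ha
      refine ⟨a + b, ?_⟩
      rw [mul_sub, ← mul_assoc, ← mul_assoc, hf, hα, sub_eq_iff_eq_add] at hb
      rw [hb, mul_add, add_comm]
  intro y hy
  exact main m 0 rfl y (by simpa [Submodule.pow_zero, Ideal.IsTwoSided.mul_one, Submodule.one_mul] using hy)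

theorem IsCNakayama.exists_arrows (hA : IsCNakayama K e) : ∃ α, IsArrows e α := by
  obtain ⟨m, hm⟩ := hA.exists_pow_eq_bot
  choose x hx h using hA.exists_arrow
  have h1 : ∀ i, e i * (e i * (x i * e (i + 1))) = e i * (x i * e (i + 1)) := fun i => by
    rw [← mul_assoc, hA.idem_mul]
  have h2 : ∀ i, e i * (x i * e (i + 1)) * e (i + 1) = e i * (x i * e (i + 1)) := fun i => by
    rw [mul_assoc, mul_assoc, hA.idem_mul]
  refine ⟨fun i => e i * (x i * e (i + 1)),
    fun i => Ideal.mul_mem_left _ _ (Ideal.mul_mem_right _ _ (hx i)), h1, h2, fun i => ?_,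
    fun i => ?_⟩
  · refine exists_left_factor hm (hA.idem_mul _) (h2 i) fun y hy => ?_
    obtain ⟨c, hc⟩ := h i y hy
    refine ⟨c • 1, ?_⟩
    -- Of the Peirce components e_j y e_{i+1}, only j = i can survive modulo J², because no other
    -- vertex has an arrow to i + 1.
    have : y * e (i + 1) = e i * (y * e (i + 1)) +
        ∑ j ∈ Finset.univ.erase i, e j * (y * e (i + 1)) := by
      rw [Finset.add_sum_erase _ (fun j => e j * (y * e (i + 1))) (Finset.mem_univ i), ← Finset.sum_mul, hA.idem.complete, one_mul]
    rw [this, smul_one_mul, add_sub_right_comm]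
    refine add_mem hc (sum_mem fun j hj => hA.mul_mul_mem_sq (fun hij => ?_) hy)
    exact Finset.ne_of_mem_erase hj (add_right_cancel hij).symm
  · refine exists_right_factor hm (hA.idem_mul _) (h1 i) fun y hy => ?_
    obtain ⟨c, hc⟩ := h i y hy
    refine ⟨c • 1, ?_⟩
    have : e i * y = e i * (y * e (i + 1)) +
        ∑ j ∈ Finset.univ.erase (i + 1), e i * (y * e j) := by
      rw [Finset.add_sum_erase _ (fun j => e i * (y * e j)) (Finset.mem_univ (i + 1)), ← Finset.mul_sum, ← Finset.mul_sum,
        hA.idem.complete, mul_one]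
    rw [this, mul_smul_one, add_sub_right_comm]
    exact add_mem hc (sum_mem fun j hj => hA.mul_mul_mem_sq (Finset.ne_of_mem_erase hj) hy)

/-! ### Socles and projective-injective modules -/

/-- The last power of J not annihilating y contains such a u. -/
theorem exists_left_socle {J : Ideal A} [J.IsTwoSided] {m : ℕ} (hm : J ^ m = ⊥) {y : A}
    (hy : y ≠ 0) : ∃ u, u * y ≠ 0 ∧ ∀ x ∈ J, x * (u * y) = 0 := by
  have : ∀ k, (∀ x ∈ J ^ k, x * y = 0) → ∃ u, u * y ≠ 0 ∧ ∀ x ∈ J, x * (u * y) = 0 := by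
    intro k
    induction k with
    | zero => exact fun h => absurd (by simpa using h 1 (by simp [Submodule.pow_zero])) hy
    | succ k ih =>
      intro h
      by_cases hk : ∀ x ∈ J ^ k, x * y = 0
      · exact ih hk
      · push Not at hk
        obtain ⟨u, hu, hu0⟩ := hk
        refine ⟨u, hu0, fun x hx => ?_⟩
        rw [← mul_assoc]
        exact h _ (by rw [Ideal.IsTwoSided.pow_succ]; exact Ideal.mul_mem_mul hx hu)
  exact this m (by simp [hm])

/-- In an arbitrary right module, a submodule which does not contain `c` has a multiple of `c`
in its socle. -/
theorem exists_right_socle {J : Ideal A} [J.IsTwoSided] {m : ℕ} (hm : J ^ m = ⊥) {E : Type*}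
    [AddCommGroup E] [Module Aᵐᵒᵖ E] (X : Submodule Aᵐᵒᵖ E) {c : E} (hc : c ∉ X) :
    ∃ a : A, MulOpposite.op a • c ∉ X ∧ ∀ x ∈ J, MulOpposite.op (a * x) • c ∈ X := by
  have : ∀ k, (∀ x ∈ J ^ k, MulOpposite.op x • c ∈ X) →
      ∃ a : A, MulOpposite.op a • c ∉ X ∧ ∀ x ∈ J, MulOpposite.op (a * x) • c ∈ X := by
    intro k
    induction k with
    | zero => exact fun h => absurd (by simpa using h 1 (by simp [Submodule.pow_zero])) hc
    | succ k ih =>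
      intro h
      by_cases hk : ∀ x ∈ J ^ k, MulOpposite.op x • c ∈ X
      · exact ih hk
      · push Not at hk
        obtain ⟨u, hu, hu0⟩ := hk
        exact ⟨u, hu0, fun x hx => h _ (by rw [Submodule.pow_succ]; exact Ideal.mul_mem_mul hu hx)⟩
  exact this m (by simp [hm])

end Structure

end Nak

namespace Nak

/-! ### Projective-injective modules from biserial socle elements -/

section ProjectiveInjective

variable {K A : Type u} [Field K] [Ring A] [Algebra K A] {n : ℕ} [NeZero n] {e : ZMod n → A}

theorem mem_leftIdeal {f x : A} (hf : f * f = f) : x ∈ leftIdeal f ↔ x * f = x := by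
  rw [Submodule.mem_span_singleton]
  refine ⟨?_, fun h => ⟨x, h⟩⟩
  rintro ⟨a, rfl⟩
  rw [smul_eq_mul, mul_assoc, hf]

theorem mem_rightIdeal {f x : A} (hf : f * f = f) : x ∈ rightIdeal f ↔ f * x = x := by
  rw [Submodule.mem_span_singleton]
  refine ⟨?_, fun h => ⟨MulOpposite.op x, h⟩⟩
  rintro ⟨a, rfl⟩
  rw [MulOpposite.smul_eq_mul_unop, ← mul_assoc, hf]

theorem rightIdeal_projective {f : A} (hf : f * f = f) :
    Module.Projective Aᵐᵒᵖ (rightIdeal f) := by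
  refine Module.Projective.of_split (M := A) (rightIdeal f).subtype
    { toFun := fun x => ⟨f * x, (mem_rightIdeal hf).2 (by rw [← mul_assoc, hf])⟩
      map_add' := fun x y => Subtype.ext (mul_add _ _ _)
      map_smul' := fun c x => Subtype.ext (mul_assoc _ _ _).symm } ?_
  ext x
  exact (mem_rightIdeal hf).1 x.2

/-- By Baer's criterion: a map g from a right ideal to D(Af) is determined by the K-functional x ↦
g(x)(f). Extend this functional linearly to μ on the whole ring; then z ↦ (y ↦ μ(yz)) extends g. -/
theorem kdual_injective {f : A} (hf : f * f = f) :
    Module.Injective Aᵐᵒᵖ (KDual K (leftIdeal f)) := by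
  refine Module.Baer.injective fun I g => ?_
  let f' : leftIdeal f := ⟨f, (mem_leftIdeal hf).2 hf⟩
  let κ : I.restrictScalars K →ₗ[K] K :=
    { toFun := fun x => (show leftIdeal f →ₗ[K] K from g x) f'
      map_add' := fun x y => by
        rw [show g (x + y : I.restrictScalars K) = g x + g y from map_add g _ _]
        rfl
      map_smul' := fun c x => by
        have : g (c • x : I.restrictScalars K) = algebraMap K Aᵐᵒᵖ c • g x := by
          refine Eq.trans (congrArg g (Subtype.ext ?_)) (map_smul g (algebraMap K Aᵐᵒᵖ c) x)
          exact Algebra.smul_def c (x : Aᵐᵒᵖ)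
        rw [this]
        refine Eq.trans ?_ ((show leftIdeal f →ₗ[K] K from g x).map_smul c f')
        refine congrArg (show leftIdeal f →ₗ[K] K from g x) (Subtype.ext ?_)
        exact (Algebra.smul_def _ _).symm }
  obtain ⟨μ, hμ⟩ := κ.exists_extend
  let h : Aᵐᵒᵖ →ₗ[Aᵐᵒᵖ] KDual K (leftIdeal f) :=
    { toFun := fun z => μ ∘ₗ (LinearMap.mulRight K z) ∘ₗ
        (MulOpposite.opLinearEquiv K).toLinearMap ∘ₗ
          (leftIdeal f).subtype.restrictScalars K
      map_add' := fun z w => LinearMap.ext fun y =>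
        (congrArg μ (mul_add _ _ _)).trans (map_add μ _ _)
      map_smul' := fun c z => LinearMap.ext fun y =>
        congrArg μ (mul_assoc (MulOpposite.op y.1) c z).symm }
  refine ⟨h, fun z hz => LinearMap.ext fun y => ?_⟩
  have h1 := LinearMap.congr_fun hμ ⟨MulOpposite.op y.1 * z, I.mul_mem_left _ hz⟩
  refine h1.trans ?_
  have h2 : g ⟨MulOpposite.op y.1 * z, I.mul_mem_left _ hz⟩ = MulOpposite.op y.1 • g ⟨z, hz⟩ :=
    map_smul g (MulOpposite.op y.1) ⟨z, hz⟩
  refine (congrArg (fun l : KDual K (leftIdeal f) =>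
    (show leftIdeal f →ₗ[K] K from l) f') h2).trans ?_
  exact congrArg (show leftIdeal f →ₗ[K] K from g ⟨z, hz⟩)
    (Subtype.ext ((mem_leftIdeal hf).1 y.2))

/-- In the uniserial Ae_j the submodules At and Ay are comparable. If Ay ⊆ At = Kt, then y is a
nonzero scalar multiple of t. -/
theorem IsCNakayama.exists_eq_mul_left (hA : IsCNakayama K e) {w j : ZMod n} {t y : A}
    (hwt : e w * t = t) (htj : t * e j = t) (hJt : ∀ x ∈ Ring.jacobson A, x * t = 0)
    (hy0 : y ≠ 0) (hyj : y * e j = y) : ∃ b, t = b * y := by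
  let t' : leftIdeal (e j) := ⟨t, (mem_leftIdeal (hA.idem_mul j)).2 htj⟩
  let y' : leftIdeal (e j) := ⟨y, (mem_leftIdeal (hA.idem_mul j)).2 hyj⟩
  obtain h | h := hA.left_uniserial j (Submodule.span A {t'}) (Submodule.span A {y'})
  · obtain ⟨b, hb⟩ := Submodule.mem_span_singleton.1 (h (Submodule.mem_span_singleton_self t'))
    exact ⟨b, (congrArg Subtype.val hb).symm⟩
  · obtain ⟨b, hb⟩ := Submodule.mem_span_singleton.1 (h (Submodule.mem_span_singleton_self y'))
    have hb : b * t = y := congrArg Subtype.val hb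
    obtain ⟨c, hc, -⟩ := hA.exists_scalar b w
    have h1 := hJt _ hc
    rw [sub_mul, mul_assoc, hwt, hb, smul_mul_assoc, hwt, sub_eq_zero] at h1
    have hc0 : c ≠ 0 := by rintro rfl; exact hy0 (by rw [h1, zero_smul])
    exact ⟨c⁻¹ • 1, by rw [h1, smul_one_mul, inv_smul_smul₀ hc0]⟩

theorem IsCNakayama.exists_eq_mul_right (hA : IsCNakayama K e) {w j : ZMod n} {t y : A}
    (hwt : e w * t = t) (htj : t * e j = t) (htJ : ∀ x ∈ Ring.jacobson A, t * x = 0)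
    (hy0 : y ≠ 0) (hwy : e w * y = y) : ∃ b, t = y * b := by
  let t' : rightIdeal (e w) := ⟨t, (mem_rightIdeal (hA.idem_mul w)).2 hwt⟩
  let y' : rightIdeal (e w) := ⟨y, (mem_rightIdeal (hA.idem_mul w)).2 hwy⟩
  obtain h | h := hA.right_uniserial w (Submodule.span Aᵐᵒᵖ {t'}) (Submodule.span Aᵐᵒᵖ {y'})
  · obtain ⟨b, hb⟩ := Submodule.mem_span_singleton.1 (h (Submodule.mem_span_singleton_self t'))
    exact ⟨b.unop, (congrArg Subtype.val hb).symm⟩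
  · obtain ⟨b, hb⟩ := Submodule.mem_span_singleton.1 (h (Submodule.mem_span_singleton_self y'))
    have hb : t * b.unop = y := congrArg Subtype.val hb
    obtain ⟨c, -, hc⟩ := hA.exists_scalar b.unop j
    have h1 := htJ _ hc
    rw [mul_sub, ← mul_assoc, htj, hb, mul_smul_comm, htj, sub_eq_zero] at h1
    have hc0 : c ≠ 0 := by rintro rfl; exact hy0 (by rw [h1, zero_smul])
    exact ⟨c⁻¹ • 1, by rw [h1, mul_smul_one, inv_smul_smul₀ hc0]⟩

/-- An element in both the socle of `e w A` and the socle of `A e j` induces a nondegenerate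
pairing between these two modules. -/
theorem IsCNakayama.nonempty_equiv_kdual (hA : IsCNakayama K e) {w j : ZMod n} {t : A}
    (ht0 : t ≠ 0) (hwt : e w * t = t) (htj : t * e j = t) (hJt : ∀ x ∈ Ring.jacobson A, x * t = 0)
    (htJ : ∀ x ∈ Ring.jacobson A, t * x = 0) :
    Nonempty (rightIdeal (e w) ≃ₗ[Aᵐᵒᵖ] KDual K (leftIdeal (e j))) := by
  have := hA.finite
  obtain ⟨l, hl⟩ := Module.Projective.exists_dual_ne_zero K ht0
  let V : Submodule K A := (rightIdeal (e w)).restrictScalars K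
  let W : Submodule K A := (leftIdeal (e j)).restrictScalars K
  -- The pairing is l(xy) with l(t) ≠ 0; every nonzero x or y can be completed to the product t, so
  -- both radicals vanish, and injectivity on both sides forces equal dimensions.
  let B : V →ₗ[K] W →ₗ[K] K := ((LinearMap.mul K A).compr₂ l).domRestrict₁₂ V W
  have hB : Function.Injective B := by
    rw [injective_iff_map_eq_zero]
    rintro ⟨x, hx⟩ h0
    by_contra hne
    have hwx := (mem_rightIdeal (hA.idem_mul w)).1 hx
    obtain ⟨b, hb⟩ := hA.exists_eq_mul_right hwt htj htJ (fun h => hne (Subtype.ext h)) hwx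
    refine hl ?_
    have := LinearMap.congr_fun h0 ⟨b * e j, (mem_leftIdeal (hA.idem_mul j)).2
      (by rw [mul_assoc, hA.idem_mul])⟩
    rw [← htj, hb, mul_assoc]
    exact this
  have hB' : Function.Injective B.flip := by
    rw [injective_iff_map_eq_zero]
    rintro ⟨y, hy⟩ h0
    by_contra hne
    have hyj := (mem_leftIdeal (hA.idem_mul j)).1 hy
    obtain ⟨b, hb⟩ := hA.exists_eq_mul_left hwt htj hJt (fun h => hne (Subtype.ext h)) hyj
    refine hl ?_
    have := LinearMap.congr_fun h0 ⟨e w * b, (mem_rightIdeal (hA.idem_mul w)).2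
      (by rw [← mul_assoc, hA.idem_mul])⟩
    rw [← hwt, hb, ← mul_assoc]
    exact this
  have hdim : Module.finrank K V = Module.finrank K (W →ₗ[K] K) := by
    refine le_antisymm (LinearMap.finrank_le_finrank_of_injective hB) ?_
    have := LinearMap.finrank_le_finrank_of_injective hB'
    rw [Subspace.dual_finrank_eq] at this
    rwa [Subspace.dual_finrank_eq]
  have hsurj := (LinearMap.injective_iff_surjective_of_finrank_eq_finrank hdim).1 hB
  let f : rightIdeal (e w) →ₗ[Aᵐᵒᵖ] KDual K (leftIdeal (e j)) :=
    { toFun := fun x => B x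
      map_add' := fun x y => map_add B x y
      map_smul' := fun a x => LinearMap.ext fun y => congrArg l (mul_assoc x.1 a.unop y.1) }
  exact ⟨LinearEquiv.ofBijective f ⟨hB, hsurj⟩⟩

/-- The simple right module at the vertex `j` embeds in `A`. -/
def SocleVertex (e : ZMod n → A) (j : ZMod n) : Prop :=
  ∃ s : A, s * e j ≠ 0 ∧ ∀ x ∈ Ring.jacobson A, s * x = 0

theorem IsCNakayama.exists_biserial_socle (hA : IsCNakayama K e) {j : ZMod n} {s : A}
    (hs0 : s ≠ 0) (hsj : s * e j = s) (hsJ : ∀ x ∈ Ring.jacobson A, s * x = 0) :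
    ∃ (w : ZMod n) (u : A), u * s ≠ 0 ∧ e w * u = u ∧
      Nonempty (rightIdeal (e w) ≃ₗ[Aᵐᵒᵖ] KDual K (leftIdeal (e j))) := by
  obtain ⟨m, hm⟩ := hA.exists_pow_eq_bot
  obtain ⟨u, hu0, huJ⟩ := exists_left_socle hm hs0
  obtain ⟨w, hw⟩ := hA.exists_idem_mul_ne_zero hu0
  refine ⟨w, e w * u, by rwa [mul_assoc], by rw [← mul_assoc, hA.idem_mul],
    hA.nonempty_equiv_kdual hw ?_ ?_ ?_ ?_⟩
  · rw [← mul_assoc, hA.idem_mul]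
  · rw [mul_assoc, mul_assoc, hsj]
  · intro x hx
    rw [← mul_assoc]
    exact huJ _ (Ideal.mul_mem_right _ _ hx)
  · intro x hx
    rw [mul_assoc, mul_assoc, hsJ x hx, mul_zero, mul_zero]

theorem IsCNakayama.projective_kdual (hA : IsCNakayama K e) {j : ZMod n} (hj : SocleVertex e j) :
    Module.Projective Aᵐᵒᵖ (KDual K (leftIdeal (e j))) := by
  obtain ⟨s, hs0, hs⟩ := hj
  obtain ⟨w, u, -, -, ⟨f⟩⟩ := hA.exists_biserial_socle hs0
    (by rw [mul_assoc, hA.idem_mul]) (fun x hx => by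
      rw [mul_assoc]; exact hs _ (Ideal.mul_mem_left _ _ hx))
  have := rightIdeal_projective (hA.idem_mul w)
  exact Module.Projective.of_equiv f

/-- The algebra embeds, as a right module, in a projective-injective module. -/
theorem IsCNakayama.exists_projective_injective (hA : IsCNakayama K e) :
    ∃ (F : ModuleCat.{u} Aᵐᵒᵖ) (ι : A →ₗ[Aᵐᵒᵖ] F), Module.Injective Aᵐᵒᵖ F ∧
      Module.Projective Aᵐᵒᵖ F ∧ Module.Finite Aᵐᵒᵖ F ∧ Function.Injective ι := by
  obtain ⟨m, hm⟩ := hA.exists_pow_eq_bot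
  -- Left multiplication by u maps e_iA to e_wA. It is injective because it does not kill a socle
  -- element lying in every nonzero submodule of e_iA.
  have key : ∀ i, ∃ (w : ZMod n) (u : A), e w * u = u ∧
      Module.Injective Aᵐᵒᵖ (rightIdeal (e w)) ∧ ∀ x, e i * x ≠ 0 → u * (e i * x) ≠ 0 := by
    intro i
    obtain ⟨a, ha0, haJ⟩ := exists_right_socle hm (⊥ : Submodule Aᵐᵒᵖ A) (c := e i)
      (by simpa using hA.idem_ne_zero i)
    simp only [Submodule.mem_bot, op_smul_eq_mul] at ha0 haJ
    obtain ⟨j, hj⟩ := hA.exists_mul_idem_ne_zero ha0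
    have h1 : ∀ x ∈ Ring.jacobson A, e i * a * e j * x = 0 := fun x hx => by
      rw [mul_assoc, mul_assoc]
      exact haJ _ (Ideal.mul_mem_left _ _ hx)
    have h2 : e i * (e i * a * e j) = e i * a * e j := by
      rw [mul_assoc, ← mul_assoc, hA.idem_mul]
    have h3 : e i * a * e j * e j = e i * a * e j := by rw [mul_assoc, hA.idem_mul]
    obtain ⟨w, u, hu0, hwu, ⟨f⟩⟩ := hA.exists_biserial_socle hj h3 h1
    have := kdual_injective (K := K) (hA.idem_mul j)
    refine ⟨w, u, hwu, injective_of_retract f.toLinearMap f.symm.toLinearMap (by ext; simp),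
      fun x hx h0 => hu0 ?_⟩
    obtain ⟨b, hb⟩ := hA.exists_eq_mul_right h2 h3 h1 hx (by rw [← mul_assoc, hA.idem_mul])
    rw [hb, ← mul_assoc, h0, zero_mul]
  choose w v hwv hinj hv using key
  have h1 : ∀ i, Module.Projective Aᵐᵒᵖ (rightIdeal (e (w i))) := fun i =>
    rightIdeal_projective (hA.idem_mul _)
  let ι : A →ₗ[Aᵐᵒᵖ] ∀ i, rightIdeal (e (w i)) := LinearMap.pi fun i =>
    { toFun := fun x => ⟨v i * (e i * x), (mem_rightIdeal (hA.idem_mul _)).2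
        (by rw [← mul_assoc, hwv])⟩
      map_add' := fun x y => Subtype.ext (by simp [mul_add])
      map_smul' := fun c x => Subtype.ext (by simp [mul_assoc]) }
  refine ⟨ModuleCat.of Aᵐᵒᵖ (∀ i, rightIdeal (e (w i))), ι, Module.Injective.pi _ _,
    projective_pi _, inferInstanceAs (Module.Finite Aᵐᵒᵖ (∀ i, rightIdeal (e (w i)))), ?_⟩
  refine (injective_iff_map_eq_zero ι).2 fun x hx => ?_
  by_contra hne
  obtain ⟨i, hi⟩ := hA.exists_idem_mul_ne_zero hne
  exact hv i x hi (congrArg Subtype.val (congrFun hx i))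

end ProjectiveInjective

end Nak

namespace Nak

open MulOpposite

/-! ### Divisibility by arrows and balanced modules -/

section Arrows

variable {A : Type u} [Ring A] {n : ℕ} {e α : ZMod n → A}

/-- The coordinates of x in a dual basis lie in J, and J e_{j+1} ⊆ A α_j divides each of them by the
arrow. -/
theorem IsArrows.exists_smul_eq (hα : IsArrows e α) {P : Type u} [AddCommGroup P]
    [Module Aᵐᵒᵖ P] [Module.Finite Aᵐᵒᵖ P] [Module.Projective Aᵐᵒᵖ P] {x : P}
    (hx : ∀ h : P →ₗ[Aᵐᵒᵖ] A, h x ∈ Ring.jacobson A) (j : ZMod n) :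
    ∃ q : P, op (e (j + 1)) • x = op (α j) • q := by
  obtain ⟨k, y, g, hg⟩ := exists_dual_basis (A := A) P
  choose c hc using fun i => hα.left j (g i x) (hx _)
  refine ⟨∑ i, op (c i) • y i, ?_⟩
  conv_lhs => rw [hg x]
  simp only [Finset.smul_sum, ← mul_smul, ← op_mul, hc]

/-- Whenever the simple module at `j` does not embed in `A`, the simple module at `j + 1` does not
occur in the top of `X`. -/
def IsBalanced (e α : ZMod n → A) (X : Type u) [AddCommGroup X] [Module Aᵐᵒᵖ X] : Prop :=
  ∀ j, ¬ SocleVertex e j → ∀ x : X, ∃ q : X, op (e (j + 1)) • x = op (α j) • q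

theorem isBalanced_pi {m : ℕ} {X : Fin m → Type u} [∀ k, AddCommGroup (X k)]
    [∀ k, Module Aᵐᵒᵖ (X k)] (h : ∀ k, IsBalanced e α (X k)) : IsBalanced e α (∀ k, X k) := by
  intro j hj x
  choose q hq using fun k => h k j hj (x k)
  exact ⟨q, funext hq⟩

theorem IsBalanced.of_equiv {X Y : Type u} [AddCommGroup X] [Module Aᵐᵒᵖ X] [AddCommGroup Y]
    [Module Aᵐᵒᵖ Y] (f : Y ≃ₗ[Aᵐᵒᵖ] X) (h : IsBalanced e α X) : IsBalanced e α Y := by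
  intro j hj y
  obtain ⟨q, hq⟩ := h j hj (f y)
  refine ⟨f.symm q, f.injective ?_⟩
  rw [map_smul, map_smul, hq, f.apply_symm_apply]

end Arrows

/-! ### Radical, projective covers and balance -/

section Radical

variable {K A : Type u} [Field K] [Ring A] [Algebra K A] {n : ℕ} [NeZero n] {e α : ZMod n → A}

theorem IsCNakayama.isNilpotent_of_mem (hA : IsCNakayama K e) {x : A}
    (hx : x ∈ Ring.jacobson A) : IsNilpotent x := by
  obtain ⟨m, hm⟩ := hA.exists_pow_eq_bot
  exact ⟨m, by simpa [hm] using Submodule.pow_mem_pow _ hx m⟩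

theorem IsCNakayama.exists_one_sub_mul (hA : IsCNakayama K e) {x : A}
    (hx : x ∈ Ring.jacobson A) : ∃ b, (1 - x) * b = 1 :=
  (hA.isNilpotent_of_mem hx).isUnit_one_sub.exists_right_inv

theorem IsCNakayama.idem_mul_mem (hA : IsCNakayama K e) {a : A} {i : ZMod n}
    (h : e i * a * e i ∈ Ring.jacobson A) : e i * a ∈ Ring.jacobson A := by
  rw [← mul_one (e i * a), ← hA.idem.complete, Finset.mul_sum]
  refine sum_mem fun j _ => ?_
  obtain rfl | hj := eq_or_ne i j
  · exact h
  · exact hA.mul_mul_mem a hj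

theorem IsCNakayama.mul_idem_mem (hA : IsCNakayama K e) {a : A} {i : ZMod n}
    (h : e i * a * e i ∈ Ring.jacobson A) : a * e i ∈ Ring.jacobson A := by
  rw [← one_mul (a * e i), ← hA.idem.complete, Finset.sum_mul]
  refine sum_mem fun j _ => ?_
  rw [← mul_assoc]
  obtain rfl | hj := eq_or_ne j i
  · exact h
  · exact hA.mul_mul_mem a hj

theorem IsCNakayama.isArtinianRing_op (hA : IsCNakayama K e) : IsArtinianRing Aᵐᵒᵖ :=
  have := hA.finite
  isArtinian_of_tower K inferInstance

/-- The kernel of a projective cover lies in the radical. -/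
theorem IsCNakayama.apply_mem_of_cover (hA : IsCNakayama K e) {P G : Type u} [AddCommGroup P]
    [Module Aᵐᵒᵖ P] [AddCommGroup G] [Module Aᵐᵒᵖ G] {f : P →ₗ[Aᵐᵒᵖ] G}
    (hf : IsProjectiveCover f) {x : P} (hx : f x = 0) (h : P →ₗ[Aᵐᵒᵖ] A) :
    h x ∈ Ring.jacobson A := by
  obtain ⟨φ, -, hker⟩ := hA.elementary
  rw [← hker, RingHom.mem_ker]
  ext k
  by_contra hk
  -- If h x had a nonzero k-th coordinate modulo J, then N, the kernel of that coordinate, would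
  -- satisfy N + xA = P. As x ∈ ker f, this gives N = P, although x ∉ N.
  let N : Submodule Aᵐᵒᵖ P :=
    { carrier := {p | φ (h p) k = 0}
      add_mem' := fun {p q} hp hq => by
        simp only [Set.mem_ofPred_eq] at hp hq ⊢
        rw [map_add, map_add, Pi.add_apply, hp, hq, add_zero]
      zero_mem' := by simp
      smul_mem' := fun c p hp => by
        simp only [Set.mem_ofPred_eq] at hp ⊢
        rw [map_smul, MulOpposite.smul_eq_mul_unop, map_mul, Pi.mul_apply, hp, zero_mul] }
  have hN : N = ⊤ := by
    refine hf.superfluous N (eq_top_iff.2 fun p _ => ?_)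
    let c : A := algebraMap K A (φ (h p) k / φ (h x) k)
    refine Submodule.mem_sup.2 ⟨p - op c • x, ?_, op c • x, ?_, sub_add_cancel _ _⟩
    · have : φ (h x) k ≠ 0 := hk
      change φ (h (p - op c • x)) k = 0
      rw [map_sub, map_smul, op_smul_eq_mul, map_sub, map_mul, AlgHom.commutes]
      simp [mul_div_cancel₀ _ this]
    · rw [LinearMap.mem_ker, map_smul, hx, smul_zero]
  exact hk (show x ∈ N from hN ▸ Submodule.mem_top)

/-- Since e_j J ⊆ α_j A, an element s e_j killed by α_j is killed by J; if nonzero, it would span a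
copy of S_j in A. -/
theorem IsCNakayama.mul_idem_eq_zero (hA : IsCNakayama K e) (hα : IsArrows e α) {j : ZMod n}
    (hj : ¬ SocleVertex e j) {s : A} (hs : s * α j = 0) : s * e j = 0 := by
  by_contra h0
  refine hj ⟨s * e j, by rwa [mul_assoc, hA.idem_mul], fun x hx => ?_⟩
  obtain ⟨a, ha⟩ := hα.right j x hx
  rw [mul_assoc, ha, ← mul_assoc, hs, zero_mul]

theorem IsCNakayama.smul_idem_eq_zero (hA : IsCNakayama K e) (hα : IsArrows e α) {j : ZMod n}
    (hj : ¬ SocleVertex e j) {P : Type u} [AddCommGroup P] [Module Aᵐᵒᵖ P] [Module.Finite Aᵐᵒᵖ P]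
    [Module.Projective Aᵐᵒᵖ P] {p : P} (hp : op (α j) • p = 0) : op (e j) • p = 0 := by
  by_contra h0
  obtain ⟨f, hf⟩ := exists_dual_ne_zero (A := A) h0
  refine hf ?_
  rw [map_smul, op_smul_eq_mul]
  refine hA.mul_idem_eq_zero hα hj ?_
  rw [← op_smul_eq_mul, ← map_smul, hp, map_zero]

/-- The corner e_iAe_i is local with residue field K: v is a nonzero scalar times e_i up to a
radical, hence nilpotent, correction. -/
theorem IsCNakayama.exists_mul_eq_idem (hA : IsCNakayama K e) {i : ZMod n} {v : A}
    (h1 : e i * v = v) (h2 : v * e i = v) (hv : v ∉ Ring.jacobson A) : ∃ b, v * b = e i := by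
  obtain ⟨c, hc, -⟩ := hA.exists_scalar v i
  have hc0 : c ≠ 0 := by
    rintro rfl
    rw [zero_smul, sub_zero, h2] at hc
    exact hv hc
  obtain ⟨b, hb⟩ := hA.exists_one_sub_mul
    (neg_mem (Ideal.mul_mem_left _ (algebraMap K A c⁻¹) hc))
  refine ⟨c⁻¹ • b, ?_⟩
  have h3 : v = e i * (1 - -(algebraMap K A c⁻¹ * (v * e i - c • e i))) * algebraMap K A c := by
    rw [h2, sub_neg_eq_add, ← Algebra.smul_def, ← Algebra.commutes, ← Algebra.smul_def, mul_add,
      mul_smul_comm, mul_sub, mul_one, h1, mul_smul_comm, hA.idem_mul, smul_add, smul_inv_smul₀ hc0]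
    abel
  have h4 : algebraMap K A c * (c⁻¹ • b) = b := by
    rw [mul_smul_comm, ← Algebra.smul_def, inv_smul_smul₀ hc0]
  rw [h3, mul_assoc, h4, mul_assoc, hb, mul_one]

/-- A second syzygy without projective direct summands is balanced. -/
theorem IsCNakayama.isBalanced (hA : IsCNakayama K e) (hα : IsArrows e α) {M : Type u}
    [AddCommGroup M] [Module Aᵐᵒᵖ M] (hM : IsSecondSyzygy A M)
    (hM' : ∀ N N' : Submodule Aᵐᵒᵖ M, IsCompl N N' → Module.Projective Aᵐᵒᵖ N → N = ⊥) :
    IsBalanced e α M := by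
  obtain ⟨k, φ, hφ, hφ'⟩ := hM
  intro j hj m
  by_cases hmem : ∀ i, φ (op (e (j + 1)) • m) i ∈ Ring.jacobson A
  -- All coordinates of m e_{j+1} are divisible by α_j in A^k. The quotient c e_j is killed by α_j
  -- modulo M; that cokernel is torsionless and j is not a socle vertex, so c e_j already lies in M.
  · choose c hc using fun i => hα.left j _ (hmem i)
    have h1 : op (α j) • (fun i => c i * e j) = φ (op (e (j + 1)) • m) := by
      ext i
      rw [Pi.smul_apply, op_smul_eq_mul, mul_assoc, hα.idem_mul, ← hc, map_smul, Pi.smul_apply,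
        op_smul_eq_mul, mul_assoc, hA.idem_mul]
    obtain ⟨q, hq⟩ := hφ' (fun i => c i * e j) fun θ hθ => by
      have h2 : θ (fun i => c i * e j) * α j = 0 := by
        rw [← op_smul_eq_mul, ← map_smul, h1]
        exact LinearMap.congr_fun hθ _
      have h3 : op (e j) • (fun i => c i * e j) = fun i => c i * e j := by
        ext i
        rw [Pi.smul_apply, op_smul_eq_mul, mul_assoc, hA.idem_mul]
      rw [← h3, map_smul]
      exact hA.mul_idem_eq_zero hα hj h2
    refine ⟨q, hφ ?_⟩
    rw [map_smul φ (op (α j)), hq, h1]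
  -- A coordinate outside J yields a surjection from M onto e_{j+1}A, which splits off a nonzero
  -- projective summand.
  · push Not at hmem
    obtain ⟨i, hi⟩ := hmem
    exfalso
    have hidem := hA.idem_mul (j + 1)
    let ψ : M →ₗ[Aᵐᵒᵖ] rightIdeal (e (j + 1)) :=
      { toFun := fun x => ⟨e (j + 1) * φ x i, (mem_rightIdeal hidem).2 (by rw [← mul_assoc, hidem])⟩
        map_add' := fun x y => Subtype.ext (by simp [mul_add])
        map_smul' := fun c x => Subtype.ext (by simp [mul_assoc]) }
    have hv : e (j + 1) * φ m i * e (j + 1) ∉ Ring.jacobson A := by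
      intro h
      refine hi ?_
      rw [map_smul, Pi.smul_apply, op_smul_eq_mul]
      exact hA.mul_idem_mem h
    obtain ⟨b, hb⟩ := hA.exists_mul_eq_idem (by rw [mul_assoc, ← mul_assoc, hidem])
      (by rw [mul_assoc, hidem]) hv
    have hψ : Function.Surjective ψ := by
      intro y
      refine ⟨op (e (j + 1) * b * y.1) • m, Subtype.ext ?_⟩
      change e (j + 1) * φ (op (e (j + 1) * b * y.1) • m) i = y.1
      rw [map_smul, Pi.smul_apply, op_smul_eq_mul]
      calc _ = e (j + 1) * φ m i * e (j + 1) * b * y.1 := by simp only [mul_assoc]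
        _ = y.1 := by rw [hb, (mem_rightIdeal hidem).1 y.2]
    have := rightIdeal_projective hidem
    obtain ⟨σ, hσ⟩ := Module.projective_lifting_property ψ LinearMap.id hψ
    have hσ' : ∀ y, ψ (σ y) = y := LinearMap.congr_fun hσ
    have hinj : Function.Injective σ := Function.LeftInverse.injective hσ'
    have hcompl : IsCompl (LinearMap.range σ) (LinearMap.ker ψ) := by
      refine ⟨Submodule.disjoint_def.2 ?_, codisjoint_iff.2 (eq_top_iff.2 fun x _ => ?_)⟩
      · rintro _ ⟨y, rfl⟩ hy
        rw [LinearMap.mem_ker, hσ'] at hy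
        rw [hy, map_zero]
      · refine Submodule.mem_sup.2 ⟨σ (ψ x), ⟨_, rfl⟩, x - σ (ψ x), ?_, add_sub_cancel _ _⟩
        rw [LinearMap.mem_ker, map_sub, hσ', sub_self]
    have hbot := hM' _ _ hcompl (Module.Projective.of_equiv (LinearEquiv.ofInjective σ hinj))
    let y : rightIdeal (e (j + 1)) := ⟨e (j + 1), Submodule.mem_span_singleton_self _⟩
    have hy : σ y = 0 := (Submodule.mem_bot Aᵐᵒᵖ).1 (hbot ▸ ⟨y, rfl⟩)
    exact hA.idem_ne_zero _ (congrArg Subtype.val ((map_eq_zero_iff σ hinj).1 hy))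

/-- Divisibility by α_j in G lifts to P up to an element of ker f, which is radical and hence
divisible after multiplication by e_{j+1}. -/
theorem IsCNakayama.isBalanced_cover (hA : IsCNakayama K e) (hα : IsArrows e α) {P G : Type u}
    [AddCommGroup P] [Module Aᵐᵒᵖ P] [AddCommGroup G] [Module Aᵐᵒᵖ G] [Module.Finite Aᵐᵒᵖ G]
    {f : P →ₗ[Aᵐᵒᵖ] G} (hf : IsProjectiveCover f) (hG : IsBalanced e α G) : IsBalanced e α P := by
  intro j hj p
  have := hf.finite
  have := hf.projective
  obtain ⟨g, hg⟩ := hG j hj (f p)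
  obtain ⟨q, rfl⟩ := hf.surjective g
  obtain ⟨r, hr⟩ := hα.exists_smul_eq (x := op (e (j + 1)) • p - op (α j) • q)
    (hA.apply_mem_of_cover hf (by rw [map_sub, map_smul, map_smul, hg, sub_self])) j
  refine ⟨q + r, ?_⟩
  rw [smul_sub, ← mul_smul, ← mul_smul, ← op_mul, ← op_mul, hA.idem_mul, hα.mul_idem,
    sub_eq_iff_eq_add] at hr
  rw [hr, smul_add, add_comm]

/-! ### Dominant dimension -/

/-- The points of `X` are separated by maps to `A`. -/
def IsTorsionless (A : Type u) [Ring A] (X : Type u) [AddCommGroup X] [Module Aᵐᵒᵖ X] : Prop :=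
  ∀ x : X, x ≠ 0 → ∃ f : X →ₗ[Aᵐᵒᵖ] A, f x ≠ 0

theorem IsTorsionless.of_injective {X Y : Type u} [AddCommGroup X] [Module Aᵐᵒᵖ X] [AddCommGroup Y]
    [Module Aᵐᵒᵖ Y] (h : IsTorsionless A Y) (f : X →ₗ[Aᵐᵒᵖ] Y) (hf : Function.Injective f) :
    IsTorsionless A X := fun x hx => by
  obtain ⟨g, hg⟩ := h (f x) ((map_ne_zero_iff f hf).2 hx)
  exact ⟨g ∘ₗ f, hg⟩

theorem isTorsionless_pi {ι : Type*} {X : ι → Type u} [∀ k, AddCommGroup (X k)]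
    [∀ k, Module Aᵐᵒᵖ (X k)] (h : ∀ k, IsTorsionless A (X k)) (x : ∀ k, X k) (hx : x ≠ 0) :
    ∃ f : (∀ k, X k) →ₗ[Aᵐᵒᵖ] A, f x ≠ 0 := by
  obtain ⟨k, hk⟩ := Function.ne_iff.1 hx
  obtain ⟨f, hf⟩ := h k (x k) hk
  exact ⟨f ∘ₗ LinearMap.proj k, hf⟩

theorem IsSecondSyzygy.isTorsionless {M : Type u} [AddCommGroup M] [Module Aᵐᵒᵖ M]
    (hM : IsSecondSyzygy A M) : IsTorsionless A M := by
  obtain ⟨k, φ, hφ, -⟩ := hM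
  exact IsTorsionless.of_injective (fun x hx => isTorsionless_pi
    (fun _ y hy => ⟨LinearMap.id, hy⟩) x hx) φ hφ

/-- A finitely generated module embedding in a projective-injective module has a finitely
generated projective injective hull. -/
theorem projective_hull {R : Type u} [Ring R] [IsArtinianRing R] {X F : Type u} [AddCommGroup X]
    [Module R X] [Module.Finite R X] [AddCommGroup F] [Module R F] [Module.Injective R F]
    [Module.Projective R F] [Module.Finite R F] (h : ∀ x : X, x ≠ 0 → ∃ f : X →ₗ[R] F, f x ≠ 0) :
    Module.Projective R (hull R X) ∧ Module.Finite R (hull R X) := by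
  obtain ⟨r, f, hf⟩ := exists_injective_pi h
  have := Module.Injective.pi R (fun _ : Fin r => F)
  have := projective_pi (R := R) (fun _ : Fin r => F)
  obtain ⟨i, p, hip⟩ := exists_retract_hull f hf
  exact ⟨Module.Projective.of_split i p hip, Module.Finite.of_surjective p
    (Function.RightInverse.surjective (LinearMap.congr_fun hip))⟩

theorem IsCNakayama.projective_hull (hA : IsCNakayama K e) {X : Type u} [AddCommGroup X]
    [Module Aᵐᵒᵖ X] [Module.Finite Aᵐᵒᵖ X] (hX : IsTorsionless A X) :
    Module.Projective Aᵐᵒᵖ (hull Aᵐᵒᵖ X) ∧ Module.Finite Aᵐᵒᵖ (hull Aᵐᵒᵖ X) := by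
  have := hA.isArtinianRing_op
  obtain ⟨F, ι, _, _, _, hι⟩ := hA.exists_projective_injective
  refine Nak.projective_hull (F := F) fun x hx => ?_
  obtain ⟨f, hf⟩ := hX x hx
  exact ⟨ι ∘ₗ f, (map_ne_zero_iff ι hι).2 hf⟩

theorem IsCNakayama.two_le_domDim (hA : IsCNakayama K e) (hα : IsArrows e α) {X : Type u}
    [AddCommGroup X] [Module Aᵐᵒᵖ X] [Module.Finite Aᵐᵒᵖ X] (hX : IsTorsionless A X)
    (hX' : IsBalanced e α X) : 2 ≤ domDim Aᵐᵒᵖ X := by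
  have := hA.isArtinianRing_op
  obtain ⟨m, hm⟩ := hA.exists_pow_eq_bot
  obtain ⟨hproj, hfin⟩ := hA.projective_hull hX
  obtain ⟨F, ι, hF, _, _, hι⟩ := hA.exists_projective_injective
  refine Nak.two_le_domDim X hproj (Nak.projective_hull (F := F) fun c hc => ?_).1
  obtain ⟨c, rfl⟩ := Submodule.mkQ_surjective _ c
  have hcX : c ∉ LinearMap.range (hullι Aᵐᵒᵖ X) := fun h =>
    hc ((Submodule.Quotient.mk_eq_zero _).2 h)
  obtain ⟨a, ha, haJ⟩ := exists_right_socle hm _ hcX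
  obtain ⟨j, hj⟩ : ∃ j, op (a * e j) • c ∉ LinearMap.range (hullι Aᵐᵒᵖ X) := by
    by_contra! h
    refine ha ?_
    rw [← mul_one a, ← hA.idem.complete, Finset.mul_sum, Finset.op_sum, Finset.sum_smul]
    exact sum_mem fun j _ => h j
  have hjJ : ∀ x ∈ Ring.jacobson A, op (a * e j * x) • c ∈ LinearMap.range (hullι Aᵐᵒᵖ X) :=
    fun x hx => by
      rw [mul_assoc]
      exact haJ _ (Ideal.mul_mem_left _ _ hx)
  -- Otherwise x₀ = c a α_j lies in X and balance gives x₀ = q α_j with q in X. Then c a e_j - q is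
  -- killed by α_j in the projective hull, hence by e_j, which puts c a e_j in X.
  have hs : SocleVertex e j := by
    by_contra hns
    obtain ⟨x₀, hx₀⟩ := hjJ _ (hα.mem j)
    obtain ⟨q, hq⟩ := hX' j hns x₀
    have h1 : op (α j) • (op (a * e j) • c - hullι Aᵐᵒᵖ X q) = 0 := by
      rw [smul_sub, ← mul_smul, ← op_mul, ← map_smul, ← hq, map_smul, hx₀, ← mul_smul, ← op_mul,
        mul_assoc _ (α j), hα.mul_idem, sub_self]
    have h2 := hA.smul_idem_eq_zero hα hns h1
    rw [smul_sub, ← mul_smul, ← op_mul, mul_assoc, hA.idem_mul, sub_eq_zero, ← map_smul] at h2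
    exact hj ⟨_, h2.symm⟩
  obtain ⟨s, hs0, hsJ⟩ := hs
  let f : A →ₗ[Aᵐᵒᵖ] hull Aᵐᵒᵖ X ⧸ LinearMap.range (hullι Aᵐᵒᵖ X) :=
    { toFun := fun b => op b • Submodule.mkQ (LinearMap.range (hullι Aᵐᵒᵖ X)) (op (a * e j) • c)
      map_add' := fun b b' => by rw [op_add, add_smul]
      map_smul' := fun r b => by
        rw [MulOpposite.smul_eq_mul_unop, op_mul, mul_smul, op_unop, RingHom.id_apply] }
  let g : A →ₗ[Aᵐᵒᵖ] F := ι ∘ₗ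
    { toFun := fun b => s * e j * b
      map_add' := fun b b' => mul_add _ _ _
      map_smul' := fun r b => (mul_assoc _ _ _).symm }
  -- Sending the class of c a e_j to s e_j is well defined: modulo J, e_j b is a scalar r times e_j.
  -- If r = 0 then s e_j b = 0, and r ≠ 0 would put c a e_j in X.
  obtain ⟨k, hk⟩ := exists_factor f g fun b hb => by
    have hb : op (a * e j * b) • c ∈ LinearMap.range (hullι Aᵐᵒᵖ X) := by
      rw [op_mul, mul_smul]
      exact (Submodule.Quotient.mk_eq_zero _).1 hb
    obtain ⟨r, -, hr⟩ := hA.exists_scalar b j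
    obtain rfl | hr0 := eq_or_ne r 0
    · rw [zero_smul, sub_zero] at hr
      change ι (s * e j * b) = 0
      rw [mul_assoc, hsJ _ hr, map_zero]
    · refine absurd ?_ hj
      have h1 := sub_mem hb (hjJ _ hr)
      rw [← sub_smul, ← op_sub, mul_sub, mul_assoc, mul_assoc a (e j) (e j * b),
        ← mul_assoc (e j) (e j) b, hA.idem_mul, sub_sub_cancel, mul_assoc, mul_smul_comm,
        hA.idem_mul, mul_smul_comm] at h1
      have h2 := Submodule.smul_mem _ (op (algebraMap K A r⁻¹)) h1
      rwa [← mul_smul, ← op_mul, ← Algebra.commutes, ← Algebra.smul_def, inv_smul_smul₀ hr0] at h2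
  refine ⟨k, fun h0 => hs0 ?_⟩
  have h1 : k (f 1) = 0 := by
    change k (op (1 : A) • Submodule.mkQ (LinearMap.range (hullι Aᵐᵒᵖ X)) (op (a * e j) • c)) = 0
    rw [map_smul, map_smul, map_smul, h0, smul_zero, smul_zero]
  rw [hk] at h1
  have h2 := (map_eq_zero_iff ι hι).1 h1
  exact (mul_one _).symm.trans h2

end Radical

end Nak

namespace Nak

open MulOpposite

/-! ### The Gorenstein core and Gorenstein dominance -/

section Core

variable {K A : Type u} [Field K] [Ring A] [Algebra K A] {n : ℕ} [NeZero n] {e α : ZMod n → A}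

theorem InRGp.isBalanced (hA : IsCNakayama K e) (hα : IsArrows e α) {M : Type u} [AddCommGroup M]
    [Module Aᵐᵒᵖ M] (hM : InRGp A M) : IsBalanced e α M :=
  have := hA.isNoetherianRing
  hA.isBalanced hα hM.1.isSecondSyzygy hM.2

/-- A summand of an indecomposable module is zero or everything, and nonprojectivity excludes the
second case for a projective summand. -/
theorem IsIndecNonprojGp.inRGp {X : Type u} [AddCommGroup X] [Module Aᵐᵒᵖ X]
    (hX : IsIndecNonprojGp A X) : InRGp A X := by
  refine ⟨hX.2.2, fun N N' hN hproj => (hX.1.2 N N' hN).resolve_right fun h => hX.2.1 ?_⟩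
  have hN' : N = ⊤ := by simpa [h] using hN.sup_eq_top
  subst hN'
  exact Module.Projective.of_equiv Submodule.topEquiv

theorem InRGp.two_le_domDim (hA : IsCNakayama K e) {M : Type u} [AddCommGroup M]
    [Module Aᵐᵒᵖ M] (hM : InRGp A M) : 2 ≤ domDim Aᵐᵒᵖ M := by
  have := hA.isNoetherianRing
  obtain ⟨α, hα⟩ := hA.exists_arrows
  have : Module.Finite Aᵐᵒᵖ M := hM.1.1
  exact hA.two_le_domDim hα hM.1.isSecondSyzygy.isTorsionless (hM.isBalanced hA hα)

theorem InGorensteinCore.two_le_domDim (hA : IsCNakayama K e) {M : Type u} [AddCommGroup M]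
    [Module Aᵐᵒᵖ M] (hM : InGorensteinCore A M) : 2 ≤ domDim Aᵐᵒᵖ M := by
  have := hA.isNoetherianRing
  obtain ⟨α, hα⟩ := hA.exists_arrows
  obtain ⟨m, X, hX, ⟨f⟩⟩ := hM
  have key : ∀ k, Module.Finite Aᵐᵒᵖ (X k) ∧ IsTorsionless A (X k) ∧ IsBalanced e α (X k) := by
    intro k
    obtain h | ⟨G, g, hG, hg⟩ := hX k
    · exact ⟨h.2.2.1, h.2.2.isSecondSyzygy.isTorsionless, h.inRGp.isBalanced hA hα⟩
    · have : Module.Finite Aᵐᵒᵖ G := hG.2.2.1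
      have := hg.finite
      have := hg.projective
      exact ⟨hg.finite, fun x hx => exists_dual_ne_zero hx,
        hA.isBalanced_cover hα hg (hG.inRGp.isBalanced hA hα)⟩
  have := fun k => (key k).1
  have : Module.Finite Aᵐᵒᵖ M := Module.Finite.equiv f.symm
  exact hA.two_le_domDim hα
    (IsTorsionless.of_injective (isTorsionless_pi fun k => (key k).2.1) f.toLinearMap f.injective)
    ((isBalanced_pi fun k => (key k).2.2).of_equiv f)

theorem IsCNakayama.isGorensteinDominant (hA : IsCNakayama K e) : IsGorensteinDominant A :=
  ⟨one_le_domDim A (hA.projective_hull fun _ hx => ⟨LinearMap.id, hx⟩).1,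
    fun _ _ _ hM => hM.two_le_domDim hA⟩

end Core

/-! ### Arrows of the resolution quiver and socle vertices -/

section ResolutionQuiver

variable {K A : Type u} [Field K] [Ring A] [Algebra K A] {n : ℕ} [NeZero n] {e : ZMod n → A}

/-- Nakayama's argument: if vx ∉ N, then v = w + vxb with w ∈ N, so v(1 - xb) ∈ N with 1 - xb
invertible. -/
theorem IsCNakayama.smul_mem_coatom (hA : IsCNakayama K e) {V : Type u} [AddCommGroup V]
    [Module Aᵐᵒᵖ V] {N : Submodule Aᵐᵒᵖ V} (hN : IsCoatom N) {x : A} (hx : x ∈ Ring.jacobson A)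
    (v : V) : op x • v ∈ N := by
  by_contra h
  have htop : N ⊔ Submodule.span Aᵐᵒᵖ {op x • v} = ⊤ :=
    hN.2 _ (lt_of_le_of_ne le_sup_left fun heq => h (heq ▸ Submodule.mem_sup_right
      (Submodule.mem_span_singleton_self _)))
  obtain ⟨w, hw, z, hz, hwz⟩ := Submodule.mem_sup.1 (htop ▸ Submodule.mem_top : v ∈ _)
  obtain ⟨b, rfl⟩ := Submodule.mem_span_singleton.1 hz
  obtain ⟨c, hc⟩ := hA.exists_one_sub_mul (Ideal.mul_mem_right b.unop _ hx)
  have h1 : w = op (1 - x * b.unop) • v := by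
    rw [op_sub, sub_smul, op_one, one_smul, op_mul, mul_smul, op_unop, eq_sub_iff_add_eq, hwz]
  have h2 := N.smul_mem (op c) hw
  rw [h1, ← mul_smul, ← op_mul, hc, op_one, one_smul] at h2
  exact h (N.smul_mem _ h2)

/-- The top of `e i A` is generated by an element on which `e i` acts as the identity and which is
killed by the radical. -/
theorem IsCNakayama.exists_simpleAt (hA : IsCNakayama K e) (i : ZMod n) :
    ∃ z : simpleAt e i, z ≠ 0 ∧ op (e i) • z = z ∧ ∀ x ∈ Ring.jacobson A, op x • z = 0 := by
  let v : rightIdeal (e i) := ⟨e i, Submodule.mem_span_singleton_self _⟩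
  have hv : Submodule.span Aᵐᵒᵖ {v} = ⊤ := by
    rw [eq_top_iff]
    rintro ⟨y, hy⟩ -
    exact Submodule.mem_span_singleton.2 ⟨op y,
      Subtype.ext ((mem_rightIdeal (hA.idem_mul i)).1 hy)⟩
  have hfin : Module.Finite Aᵐᵒᵖ (rightIdeal (e i)) := ⟨⟨{v}, by simpa using hv⟩⟩
  have hnt : Nontrivial (rightIdeal (e i)) :=
    ⟨v, 0, fun h => hA.idem_ne_zero i (congrArg Subtype.val h)⟩
  refine ⟨Submodule.mkQ _ v, fun h => ?_, ?_, fun x hx => ?_⟩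
  · have h1 := (Submodule.Quotient.mk_eq_zero _).1 h
    refine (Module.jacobson_lt_top Aᵐᵒᵖ (rightIdeal (e i))).ne (eq_top_iff.2 (hv ▸ ?_))
    rwa [Submodule.span_singleton_le_iff_mem]
  · rw [← map_smul]
    exact congrArg _ (Subtype.ext (hA.idem_mul i))
  · rw [← map_smul]
    refine (Submodule.Quotient.mk_eq_zero _).2 (Submodule.mem_sInf.2 fun N hN => ?_)
    exact hA.smul_mem_coatom hN hx v

theorem IsCNakayama.smul_socle_eq_zero (hA : IsCNakayama K e) {P : Type u} [AddCommGroup P]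
    [Module Aᵐᵒᵖ P] {s : P} (hs : s ∈ socle Aᵐᵒᵖ P) {x : A} (hx : x ∈ Ring.jacobson A) :
    op x • s = 0 := by
  let Z : Submodule Aᵐᵒᵖ P :=
    { carrier := {s | ∀ x ∈ Ring.jacobson A, op x • s = 0}
      add_mem' := fun {p q} hp hq x hx => by rw [smul_add, hp x hx, hq x hx, add_zero]
      zero_mem' := fun x _ => smul_zero _
      smul_mem' := fun c p hp x hx => by
        rw [← mul_smul, ← op_unop c, ← op_mul]
        exact hp _ (Ideal.mul_mem_left _ _ hx) }
  suffices h : socle Aᵐᵒᵖ P ≤ Z from h hs x hx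
  refine sSup_le fun N hN t ht x hx => ?_
  have : IsSimpleModule Aᵐᵒᵖ N := hN
  have := hA.smul_mem_coatom (N := (⊥ : Submodule Aᵐᵒᵖ N)) isCoatom_bot hx ⟨t, ht⟩
  exact congrArg Subtype.val ((Submodule.mem_bot Aᵐᵒᵖ).1 this)

theorem IsCNakayama.socleVertex_of_resArrow (hA : IsCNakayama K e) {k i : ZMod n}
    (h : ResArrow K e k i) : SocleVertex e (i - 1) := by
  obtain ⟨α, hα⟩ := hA.exists_arrows
  obtain ⟨P, f, hf, π, ⟨Φ⟩⟩ := h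
  by_contra hns
  have hi : i - 1 + 1 = i := sub_add_cancel i 1
  have hfin : Module.Finite Aᵐᵒᵖ (rightIdeal (e k)) :=
    ⟨(Submodule.fg_top _).2 (Submodule.fg_span_singleton _)⟩
  have := hf.finite
  have := hf.projective
  -- A socle element is killed by J, so if e_{i-1} did not kill it, a functional on P would produce
  -- a copy of S_{i-1} in A.
  have hsoc : ∀ s : socle Aᵐᵒᵖ P, op (e (i - 1)) • s = 0 := by
    rintro ⟨s, hs⟩
    by_contra h0
    obtain ⟨h, hh⟩ := exists_dual_ne_zero (A := A) (p := op (e (i - 1)) • s)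
      fun h => h0 (Subtype.ext h)
    rw [map_smul] at hh
    refine hns ⟨h s, hh, fun x hx => ?_⟩
    rw [← op_smul_eq_mul, ← map_smul, hA.smul_socle_eq_zero hs hx, map_zero]
  have := π.finite₀
  have := π.finite₁
  have h₀ : Module.Projective Aᵐᵒᵖ π.P₀ := π.cover₀.projective
  have h₁ : Module.Projective Aᵐᵒᵖ π.P₁ := π.cover₁.projective
  obtain ⟨z, hz0, hz1, hzJ⟩ := hA.exists_simpleAt i
  -- A generator of S_i is a nonzero functional on Tr that is fixed by e_i and kills J Tr. Thus S_i
  -- is detected in the top of P₁, by g and p below.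
  let ζ : π.Tr →ₗ[K] K := Φ z
  have hζ1 : ∀ t, ζ (e i • t) = ζ t := fun t => by
    have := LinearMap.congr_fun (show (show π.Tr →ₗ[K] K from op (e i) • Φ z) = ζ by
      rw [← map_smul, hz1]) t
    exact this
  have hζJ : ∀ x ∈ Ring.jacobson A, ∀ t, ζ (x • t) = 0 := fun x hx t => by
    have := LinearMap.congr_fun (show (show π.Tr →ₗ[K] K from op x • Φ z) = 0 by
      rw [← map_smul, hzJ x hx, map_zero]; rfl) t
    exact this
  obtain ⟨t, ht⟩ : ∃ t, ζ t ≠ 0 := by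
    by_contra! h
    exact hz0 ((map_eq_zero_iff Φ Φ.injective).1 (LinearMap.ext h))
  obtain ⟨g, rfl⟩ := Submodule.mkQ_surjective _ t
  obtain ⟨p, hp⟩ : ∃ p, (e i • g) p ∉ Ring.jacobson A := by
    by_contra! h
    obtain ⟨l, x, y, hxy⟩ := exists_dual_basis (A := A) π.P₁
    have hg : e i • g = ∑ r, (e i • g) (x r) • y r := by
      ext p
      conv_lhs => rw [hxy p]
      simp [mul_assoc]
    refine ht ?_
    rw [← hζ1, ← map_smul, hg, map_sum, map_sum]
    refine Finset.sum_eq_zero fun r _ => ?_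
    rw [map_smul]
    exact hζJ _ (h _) _
  have hp' : (e i • g) (op (e i) • p) ∉ Ring.jacobson A := by
    intro h
    refine hp (hA.idem_mul_mem ?_)
    rwa [map_smul] at h
  have hx : ∀ h : π.P₀ →ₗ[Aᵐᵒᵖ] A, h (π.d (op (e i) • p)) ∈ Ring.jacobson A :=
    hA.apply_mem_of_cover π.cover₀ (π.exact.apply_apply_eq_zero _)
  obtain ⟨q, hq⟩ := hα.exists_smul_eq hx (i - 1)
  rw [hi, ← map_smul, ← mul_smul, ← op_mul, hA.idem_mul] at hq
  -- Here d(p e_i) = q α_{i-1}, and q e_{i-1} maps into (soc P) e_{i-1} = 0, so it lifts to p₁. Then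
  -- p e_i - p₁ α_{i-1} lies in ker d, hence in the radical, and so does p e_i, contradicting the
  -- choice of p.
  obtain ⟨p₁, hp₁⟩ := (π.exact (op (e (i - 1)) • q)).1 (by rw [map_smul, hsoc])
  have hd : π.d (op (e i) • p - op (α (i - 1)) • p₁) = 0 := by
    rw [map_sub, map_smul π.d (op (α (i - 1))), hp₁, hq, ← mul_smul, ← op_mul, hα.idem_mul,
      sub_self]
  have h1 := hA.apply_mem_of_cover π.cover₁ (Subtype.ext hd) (e i • g)
  rw [map_sub, map_smul _ (op (α (i - 1)))] at h1
  refine hp' ((Submodule.sub_mem_iff_left _ ?_).1 h1)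
  exact Ideal.mul_mem_left _ _ (hα.mem _)

theorem IsCNakayama.projective_of_isCyclicallyBlack (hA : IsCNakayama K e) {i : ZMod n}
    (hi : IsCyclicallyBlack K e i) :
    Module.Projective Aᵐᵒᵖ (KDual K (leftIdeal (e (i - 1)))) := by
  obtain ⟨m, v, hm, -, hvm, h⟩ := hi
  -- The last arrow of the cycle, from v (m - 1), ends at i.
  have h1 := (h (m - 1) (by lia)).1
  rw [Nat.sub_add_cancel hm, hvm] at h1
  exact hA.projective_kdual (hA.socleVertex_of_resArrow h1)

end ResolutionQuiver

end Nak

theorem mainTheorem9 {K A : Type u} [Field K] [Ring A] [Algebra K A] {n : ℕ} [NeZero n]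
    (e : ZMod n → A) (hA : Nak.IsCNakayama K e) (hns : ¬ Module.Injective Aᵐᵒᵖ A) :
    (∀ i : ZMod n, Nak.IsCyclicallyBlack K e i →
      Module.Projective Aᵐᵒᵖ (Nak.KDual K (Nak.leftIdeal (e (i - 1))))) ∧
    (∀ (M : Type u) [AddCommGroup M] [Module Aᵐᵒᵖ M],
      Nak.InGorensteinCore A M → 2 ≤ Nak.domDim Aᵐᵒᵖ M) ∧
    Nak.IsGorensteinDominant A :=
  ⟨fun _ hi => hA.projective_of_isCyclicallyBlack hi, fun _ _ _ hM => hM.two_le_domDim hA,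
    hA.isGorensteinDominant⟩
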